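/- Let $\Gamma$ be a connected, locally finite metric graph (loops and multiple edges are allowed). Each edge $e$ is a copy of $[0,\ell_e]$ attached to vertices at both ends, or of $[0,\infty)$ attached to a vertex at $0$ (then $\ell_e=\infty$), and there is a constant $\ell_{\min}>0$ with $\ell_e\ge \ell_{\min}$ for every edge $e$. The graph may be finite or infinite. Equip $\Gamma$ with the arclength measure, so that $L^2(\Gamma)=\bigoplus_e L^2(e,dx)$. Let $V:\Gamma\to\mathbb R$ be continuous, let $i_0\subset\Gamma$ be a connected subset of positive measure, and let $E\in\mathbb R$ satisfy $E<\inf_{\Gamma\setminus i_0}V$ (where $\inf\emptyset=+\infty$). Then there exists a function $\psi:\Gamma\to\mathbb R$ in $L^2(\Gamma)$ such that: 1. at every point $x\in\Gamma\setminus i_0$ interior to an edge, $\psi$ is differentiable along the edge near $x$, twice differentiable at $x$, and $-\psi''(x)+V(x)\psi(x)=E\psi(x)$; 2. $\psi$ satisfies the Kirchhoff conditions on $\Gamma\setminus i_0$: on every compact interval contained in an open edge and in $\Gamma\setminus i_0$, $\psi$ is differentiable with absolutely continuous derivative; and at every vertex $v\in\Gamma\setminus i_0$, $\psi$ is continuous,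 it is differentiable along each edge of $\Gamma$ at $v$ near $v$, the outgoing derivatives $\psi_e'(v^+)$ (the limits at $v$ of the derivative along the edge, oriented away from $v$) exist for all these edges, and $\sum_{e\sim v}\psi_e'(v^+)=0$, a loop at $v$ being counted once for each of its two ends; 3. if $\Gamma\setminus i_0$ has positive measure, then $\psi$ is not almost everywhere zero on $\Gamma\setminus i_0$. -/

import Mathlib

open MeasureTheory Filter Topology Set
open scoped ENNReal

/-- Combinatorial data of a metric graph.  An edge `e` of length `len e = ℓ < ∞` is a copy of `[0, ℓ]`
whose endpoints `0` and `ℓ` are attached to the vertices `src e` and `tgt e`.  An edge of infinite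
length is a copy of the half-line `[0, ∞)` attached to `src e` at `0`; its value `tgt e` is never used.
Loops and multiple edges are allowed. -/
structure MetricGraph (Vert Edge : Type*) where
  /-- the length of an edge -/
  len : Edge → ℝ≥0∞
  /-- edges have positive length -/
  len_pos : ∀ e, 0 < len e
  /-- the vertex at the start of an edge -/
  src : Edge → Vert
  /-- the vertex at the end of an edge of finite length -/
  tgt : Edge → Vert

namespace MetricGraph

variable {Vert Edge : Type*} (Γ : MetricGraph Vert Edge)

/-- The points of the metric graph: its vertices and the interior points of its edges. -/
inductive Point (Γ : MetricGraph Vert Edge) : Type _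
  | vertex (v : Vert) : Point Γ
  | interior (e : Edge) (t : ℝ) (h₀ : 0 < t) (h₁ : ENNReal.ofReal t < Γ.len e) : Point Γ

open Classical in
/-- The arclength parametrization of the closed edge `e`, extended to all of `ℝ` so that it is
constant before the start and after the end of the edge. -/
noncomputable def pt (e : Edge) (t : ℝ) : Γ.Point :=
  if h₀ : 0 < t then
    if h₁ : ENNReal.ofReal t < Γ.len e then .interior e t h₀ h₁ else .vertex (Γ.tgt e)
  else .vertex (Γ.src e)

/-- The quotient topology obtained by gluing the closed edges at the vertices: a set is open
iff its preimage under each edge parametrization is open. -/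
noncomputable instance : TopologicalSpace Γ.Point :=
  ⨆ e : Edge, TopologicalSpace.coinduced (Γ.pt e) inferInstance

noncomputable instance : MeasurableSpace Γ.Point := borel Γ.Point

instance : BorelSpace Γ.Point := ⟨rfl⟩

/-- The parameters of the interior points of the edge `e`: the interval `(0, len e)`. -/
def interiorParam (e : Edge) : Set ℝ := {t | 0 < t ∧ ENNReal.ofReal t < Γ.len e}

/-- The Lebesgue (arclength) measure on the metric graph. Its `L²` space is `⨁ₑ L²(e, dx)`. -/
noncomputable def vol : Measure Γ.Point :=
  Measure.sum fun e : Edge => (volume.restrict (Γ.interiorParam e)).map (Γ.pt e)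

/-- The edge ends at the vertex `v`; a loop at `v` contributes two of them. -/
def EdgeEnd (v : Vert) : Type _ :=
  {e : Edge // Γ.src e = v} ⊕ {e : Edge // Γ.len e ≠ ∞ ∧ Γ.tgt e = v}

/-- Only finitely many edges meet at each vertex. -/
def LocallyFinite : Prop := ∀ v : Vert, Finite (Γ.EdgeEnd v)

/-- Arclength parametrization of an edge by the distance `s` from the end `a` at `v`, in the
outgoing orientation. -/
noncomputable def outgoing {v : Vert} (a : Γ.EdgeEnd v) (s : ℝ) : Γ.Point :=
  match a with
  | .inl e => Γ.pt e.1 s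
  | .inr e => Γ.pt e.1 ((Γ.len e.1).toReal - s)

/-- `f` is differentiable on its edge near the edge end `a` at `v`, and the outgoing derivative
`f_e'(v⁺)` (the limit of the derivative of `f` along the edge at the vertex) exists and is `d`. -/
def HasOutgoingDeriv (f : Γ.Point → ℝ) {v : Vert} (a : Γ.EdgeEnd v) (d : ℝ) : Prop :=
  (∀ᶠ s in 𝓝[>] (0 : ℝ), DifferentiableAt ℝ (fun r => f (Γ.outgoing a r)) s) ∧
    Tendsto (deriv fun r => f (Γ.outgoing a r)) (𝓝[>] 0) (𝓝 d)

/-- `f` is `AC¹` along the edges within the set `S`: on each compact interval inside an open edge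
and inside `S`, `f` is differentiable with absolutely continuous derivative. -/
def AC1On (S : Set Γ.Point) (f : Γ.Point → ℝ) : Prop :=
  ∀ (e : Edge) (a b : ℝ), a ≤ b → Icc a b ⊆ Γ.interiorParam e → MapsTo (Γ.pt e) (Icc a b) S →
    (∀ t ∈ Icc a b, DifferentiableAt ℝ (fun r => f (Γ.pt e r)) t) ∧
      AbsolutelyContinuousOnInterval (deriv fun r => f (Γ.pt e r)) a b

/-- `f` satisfies the Kirchhoff conditions on the set `S`: it is `AC¹` along the edges within `S`,
and at every vertex `v` in `S` it is continuous and its outgoing derivatives along all edges of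
`Γ` at `v` exist and sum to zero. -/
def KirchhoffOn (S : Set Γ.Point) (f : Γ.Point → ℝ) : Prop :=
  Γ.AC1On S f ∧
    ∀ v : Vert, Point.vertex v ∈ S →
      ContinuousAt f (Point.vertex v) ∧
        ∃ d : Γ.EdgeEnd v → ℝ, (∀ a, Γ.HasOutgoingDeriv f a (d a)) ∧ ∑ᶠ a, d a = 0

/-- `ψ` solves `-ψ'' + V ψ = E ψ` at every interior point of an edge that lies in `S`. -/
def SolvesOn (S : Set Γ.Point) (V : Γ.Point → ℝ) (E : ℝ) (ψ : Γ.Point → ℝ) : Prop :=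
  ∀ (e : Edge), ∀ t ∈ Γ.interiorParam e, Γ.pt e t ∈ S →
    (∀ᶠ s in 𝓝 t, DifferentiableAt ℝ (fun r => ψ (Γ.pt e r)) s) ∧
      ∃ d₂ : ℝ, HasDerivAt (deriv fun r => ψ (Γ.pt e r)) d₂ t ∧
        -d₂ + V (Γ.pt e t) * ψ (Γ.pt e t) = E * ψ (Γ.pt e t)

end MetricGraph

/-! Choose a real `r` with `E < r < inf V` off `i₀` and put `Q = max V r - E`. Then `Q ≥ δ = r - E >
0` everywhere, and `Q = V - E` off `i₀`. The required function is a Green's function of `-d²/dx² +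
Q` with pole at an interior point of an edge lying in `i₀` (`exists_green`). It is positive, hence
not a.e. zero on any set of positive measure, and only the pole, which is hidden in `i₀`, violates
the equation.

Along an edge a solution is fixed by its vertex values `x` through the fundamental solutions of
`EdgeProfile`, with a decay condition on half-lines. The Kirchhoff conditions thus become a linear
system for `x`: at each vertex, (sum of the diagonal coefficients `a`) times `x v` equals the sum of
`c` times the neighbouring values, plus a source from the edge of the pole.

Since `Q ≥ δ` and edges have length at least `ℓmin`, comparison with `q = 0` (`growth`) gives `c ≤ θ
a` at both ends of an edge of finite length, with `θ = (1 + δ ℓmin² / 2)⁻¹ < 1`. The Neumann series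
of the system has nonnegative terms and converges geometrically both in the supremum norm and in the
`ℓ¹` norm weighted by the vertex sums of `a` (`exists_vertex_solution_ennreal`). As `u'' ≥ δ u`, the
integral of an edge solution is controlled by its boundary slopes, so the weighted `ℓ¹` bound makes
the glued function integrable. Being also bounded, it lies in `L²`. Connectedness propagates
positivity from the source to every vertex (`vertex_solution_pos`). -/

/-- `u` solves `u'' = q u` on `ℝ`, with derivative `v`. -/
structure IsSchrodingerSol (q u v : ℝ → ℝ) : Prop where
  deriv₁ : ∀ t, HasDerivAt u (v t) t
  deriv₂ : ∀ t, HasDerivAt v (q t * u t) t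

/-! ### The initial value problem by Peano series. -/

namespace IsSchrodingerSol

/-- The terms of the Peano series of the system `u' = v`, `v' = q u`. -/
noncomputable def peano (q : ℝ → ℝ) (c : ℝ × ℝ) : ℕ → (ℝ → ℝ) × (ℝ → ℝ)
  | 0 => (fun _ => c.1, fun _ => c.2)
  | n + 1 => (fun t => ∫ s in (0 : ℝ)..t, (peano q c n).2 s,
      fun t => ∫ s in (0 : ℝ)..t, q s * (peano q c n).1 s)

theorem continuous_peano {q : ℝ → ℝ} (hq : Continuous q) (c : ℝ × ℝ) (n : ℕ) :
    Continuous (peano q c n).1 ∧ Continuous (peano q c n).2 := by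
  induction n with
  | zero => exact ⟨continuous_const, continuous_const⟩
  | succ n ih =>
    exact ⟨intervalIntegral.continuous_primitive (fun a b => ih.2.intervalIntegrable a b) 0,
      intervalIntegral.continuous_primitive
        (fun a b => (hq.mul ih.1).intervalIntegrable a b) 0⟩

theorem abs_primitive_le {g : ℝ → ℝ} (hg : Continuous g) {K R : ℝ} {n : ℕ}
    (h : ∀ t, |t| ≤ R → |g t| ≤ K * |t| ^ n) {t : ℝ} (ht : |t| ≤ R) :
    |∫ s in (0 : ℝ)..t, g s| ≤ K * (|t| ^ (n + 1) / (n + 1)) := by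
  have h1 : ‖∫ s in (0 : ℝ)..t, g s‖ ≤ ∫ s in uIoc (0 : ℝ) t, ‖g s‖ :=
    intervalIntegral.norm_integral_le_integral_norm_uIoc
  have h2 := integral_pow_abs_sub_uIoc (a := 0) (b := t) n
  simp only [sub_zero] at h2
  rw [← h2, ← integral_const_mul]
  refine h1.trans (setIntegral_mono_on ?_ ?_ measurableSet_uIoc fun s hs => ?_)
  · exact (hg.norm.intervalIntegrable 0 t).def'
  · exact ((continuous_const.mul (continuous_abs.pow n)).intervalIntegrable 0 t).def'
  · refine h s (le_trans ?_ ht)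
    rcases mem_uIoc.1 hs with h | h
    · rw [abs_of_pos h.1, abs_of_pos (h.1.trans_le h.2)]; exact h.2
    · rw [abs_of_nonpos h.2, abs_of_neg (h.1.trans_le h.2)]; linarith [h.1]

/-- With `M ≥ 1`, `M` dominates both coefficients `1` and `q` of the system. Each iteration costs a
factor `M`, and integrating `|t| ^ n` builds up the factorial that makes the series summable. -/
theorem abs_peano_le {q : ℝ → ℝ} (hq : Continuous q) (c : ℝ × ℝ) {R M : ℝ} (hM : 1 ≤ M)
    (hqM : ∀ t, |t| ≤ R → |q t| ≤ M) (n : ℕ) : ∀ t, |t| ≤ R →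
    |(peano q c n).1 t| ≤ (|c.1| + |c.2|) * M ^ n / n.factorial * |t| ^ n ∧
      |(peano q c n).2 t| ≤ (|c.1| + |c.2|) * M ^ n / n.factorial * |t| ^ n := by
  induction n with
  | zero => intro t _; simp [peano]
  | succ n ih =>
    intro t ht
    have hC : 0 ≤ (|c.1| + |c.2|) * M ^ n / n.factorial := by positivity
    have key : (|c.1| + |c.2|) * M ^ n / n.factorial * M * (|t| ^ (n + 1) / (n + 1))
        = (|c.1| + |c.2|) * M ^ (n + 1) / (n + 1).factorial * |t| ^ (n + 1) := by
      rw [Nat.factorial_succ]; push_cast; field_simp; ring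
    rw [← key]
    refine ⟨abs_primitive_le (continuous_peano hq c n).2 (fun s hs => ?_) ht,
      abs_primitive_le (hq.mul (continuous_peano hq c n).1) (fun s hs => ?_) ht⟩
    · refine (ih s hs).2.trans ?_
      gcongr
      exact le_mul_of_one_le_right hC hM
    · rw [Pi.mul_apply, abs_mul, mul_comm]
      refine (mul_le_mul (ih s hs).1 (hqM s hs) (abs_nonneg _) (by positivity)).trans_eq ?_
      ring

/-- Global solvability of the initial value problem at `0`. -/
theorem exists_sol {q : ℝ → ℝ} (hq : Continuous q) (c₀ c₁ : ℝ) :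
    ∃ u v, IsSchrodingerSol q u v ∧ u 0 = c₀ ∧ v 0 = c₁ := by
  set w := peano q (c₀, c₁) with hw
  have hc := continuous_peano hq (c₀, c₁)
  have bound : ∀ R : ℝ, 0 ≤ R → ∃ B : ℕ → ℝ, Summable B ∧ ∀ n t, |t| ≤ R →
      |(w n).1 t| ≤ B n ∧ |(w n).2 t| ≤ B n := by
    intro R hR
    obtain ⟨M, hM⟩ := (isCompact_Icc (a := -R) (b := R)).exists_bound_of_continuousOn
      hq.continuousOn
    refine ⟨fun n => (|c₀| + |c₁|) * ((max M 1 * R) ^ n / n.factorial),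
      (Real.summable_pow_div_factorial _).mul_left _, fun n t ht => ?_⟩
    have := abs_peano_le hq (c₀, c₁) (R := R) (le_max_right M 1)
      (fun t ht => (hM t (abs_le.1 ht)).trans (le_max_left _ _)) n t ht
    have h2 : (|c₀| + |c₁|) * (max M 1) ^ n / n.factorial * |t| ^ n
        ≤ (|c₀| + |c₁|) * ((max M 1 * R) ^ n / n.factorial) := by
      rw [mul_pow, mul_div_assoc, mul_assoc, div_mul_eq_mul_div]
      gcongr
    exact ⟨this.1.trans h2, this.2.trans h2⟩
  have hsum : ∀ t, Summable (fun n => (w n).1 t) ∧ Summable (fun n => (w n).2 t) := by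
    intro t
    obtain ⟨B, hB, h⟩ := bound |t| (abs_nonneg t)
    exact ⟨hB.of_norm_bounded fun n => (h n t le_rfl).1,
      hB.of_norm_bounded fun n => (h n t le_rfl).2⟩
  have hd : ∀ n t, HasDerivAt (w (n + 1)).1 ((w n).2 t) t ∧
      HasDerivAt (w (n + 1)).2 (q t * (w n).1 t) t := fun n t =>
    ⟨intervalIntegral.integral_hasDerivAt_right ((hc n).2.intervalIntegrable _ _)
        ((hc n).2.stronglyMeasurableAtFilter _ _) (hc n).2.continuousAt,
      intervalIntegral.integral_hasDerivAt_right ((hq.mul (hc n).1).intervalIntegrable _ _)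
        ((hq.mul (hc n).1).stronglyMeasurableAtFilter _ _) (hq.mul (hc n).1).continuousAt⟩
  have h0 : ∀ n, (w (n + 1)).1 0 = 0 ∧ (w (n + 1)).2 0 = 0 := fun n => by
    simp [hw, peano]
  refine ⟨fun t => ∑' n, (w n).1 t, fun t => ∑' n, (w n).2 t, ⟨fun t => ?_, fun t => ?_⟩, ?_, ?_⟩
  · obtain ⟨B, hB, h⟩ := bound (|t| + 1) (by positivity)
    -- The constant term is split off: the term of index `n + 1` differentiates to the term of index
    -- `n`, so the differentiated tail is the full series of the other component.
    have := hasDerivAt_tsum_of_isPreconnected (g := fun n => (w (n + 1)).1)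
      (g' := fun n => (w n).2) (t := Metric.ball 0 (|t| + 1)) (y₀ := t) (y := t) hB Metric.isOpen_ball
      (convex_ball _ _).isPreconnected (fun n y _ => (hd n y).1)
      (fun n y hy => (h n y (by simpa using (mem_ball_zero_iff.1 hy).le)).2)
      (by simp) ((summable_nat_add_iff 1).2 (hsum t).1) (by simp)
    have e : (fun t => ∑' n, (w n).1 t) = fun t => c₀ + ∑' n, (w (n + 1)).1 t := by
      ext s; rw [(hsum s).1.tsum_eq_zero_add]; rfl
    rw [e]
    exact this.const_add _
  · obtain ⟨B, hB, h⟩ := bound (|t| + 1) (by positivity)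
    obtain ⟨M, hM⟩ := (isCompact_Icc (a := -(|t| + 1)) (b := |t| + 1)).exists_bound_of_continuousOn
      hq.continuousOn
    have := hasDerivAt_tsum_of_isPreconnected (g := fun n => (w (n + 1)).2)
      (g' := fun n t => q t * (w n).1 t) (t := Metric.ball 0 (|t| + 1)) (y₀ := t) (y := t)
      (hB.mul_left M) Metric.isOpen_ball
      (convex_ball _ _).isPreconnected (fun n y _ => (hd n y).2)
      (fun n y hy => by
        have hy' : |y| ≤ |t| + 1 := (mem_ball_zero_iff.1 hy).le
        rw [norm_mul]
        exact mul_le_mul (hM y (abs_le.1 hy')) (h n y hy').1 (norm_nonneg _)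
          ((norm_nonneg _).trans (hM y (abs_le.1 hy'))))
      (by simp) ((summable_nat_add_iff 1).2 (hsum t).2) (by simp)
    have e : (fun t => ∑' n, (w n).2 t) = fun t => c₁ + ∑' n, (w (n + 1)).2 t := by
      ext s; rw [(hsum s).2.tsum_eq_zero_add]; rfl
    rw [e, ← tsum_mul_left]
    exact this.const_add _
  · simp only
    rw [(hsum 0).1.tsum_eq_zero_add]
    simp only [(h0 _).1, tsum_zero, add_zero]
    rfl
  · simp only
    rw [(hsum 0).2.tsum_eq_zero_add]
    simp only [(h0 _).2, tsum_zero, add_zero]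
    rfl

end IsSchrodingerSol

/-! ### Linear combinations, reflection and the Wronskian. -/

namespace IsSchrodingerSol

variable {q u v u₁ v₁ u₂ v₂ : ℝ → ℝ}

theorem continuous (h : IsSchrodingerSol q u v) : Continuous u :=
  continuous_iff_continuousAt.2 fun t => (h.deriv₁ t).continuousAt

theorem continuous_deriv (h : IsSchrodingerSol q u v) : Continuous v :=
  continuous_iff_continuousAt.2 fun t => (h.deriv₂ t).continuousAt

theorem lin_comb (h₁ : IsSchrodingerSol q u₁ v₁) (h₂ : IsSchrodingerSol q u₂ v₂) (a b : ℝ) :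
    IsSchrodingerSol q (fun t => a * u₁ t + b * u₂ t) (fun t => a * v₁ t + b * v₂ t) :=
  ⟨fun t => ((h₁.deriv₁ t).const_mul a).add ((h₂.deriv₁ t).const_mul b), fun t =>
    (((h₁.deriv₂ t).const_mul a).add ((h₂.deriv₂ t).const_mul b)).congr_deriv (by ring)⟩

theorem const_mul (h : IsSchrodingerSol q u v) (a : ℝ) :
    IsSchrodingerSol q (fun t => a * u t) (fun t => a * v t) := by
  simpa using h.lin_comb h a 0

theorem reverse {L : ℝ} (h : IsSchrodingerSol (fun t => q (L - t)) u v) :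
    IsSchrodingerSol q (fun t => u (L - t)) (fun t => -v (L - t)) := by
  refine ⟨fun t => ?_, fun t => ?_⟩
  · simpa using (h.deriv₁ (L - t)).comp_const_sub L t
  · exact ((h.deriv₂ (L - t)).comp_const_sub L t).neg.congr_deriv (by simp)

theorem wronskian (h₁ : IsSchrodingerSol q u₁ v₁) (h₂ : IsSchrodingerSol q u₂ v₂) (s t : ℝ) :
    u₁ s * v₂ s - v₁ s * u₂ s = u₁ t * v₂ t - v₁ t * u₂ t := by
  have hd : ∀ t, HasDerivAt (fun t => u₁ t * v₂ t - v₁ t * u₂ t) 0 t := fun t =>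
    (((h₁.deriv₁ t).mul (h₂.deriv₂ t)).sub ((h₁.deriv₂ t).mul (h₂.deriv₁ t))).congr_deriv (by ring)
  exact is_const_of_deriv_eq_zero (fun t => (hd t).differentiableAt) (fun t => (hd t).deriv) s t

/-! ### Positivity and growth for nonnegative potentials. -/

section Positivity

variable {α : ℝ}

theorem monotoneOn_Ici {f f' : ℝ → ℝ} (hf : ∀ t, HasDerivAt f (f' t) t)
    (h : ∀ t, α ≤ t → 0 ≤ f' t) : MonotoneOn f (Ici α) := by
  refine monotoneOn_of_deriv_nonneg (convex_Ici α)
    (fun t _ => (hf t).continuousAt.continuousWithinAt)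
    (fun t _ => (hf t).differentiableAt.differentiableWithinAt) fun t ht => ?_
  rw [interior_Ici] at ht
  rw [(hf t).deriv]
  exact h t ht.le

/-- A square bounded below by a positive number keeps `f` from vanishing. Monotonicity of squares
can thus replace a continuation argument for the sign. -/
theorem pos_of_sq_ge {f : ℝ → ℝ} (hf : Continuous f) (h0 : 0 < f α)
    (h : ∀ t, α ≤ t → f α ^ 2 ≤ f t ^ 2) {t : ℝ} (ht : α ≤ t) : 0 < f t := by
  by_contra! hn
  obtain ⟨s, hs, hs0⟩ := intermediate_value_Icc' ht hf.continuousOn ⟨hn, h0.le⟩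
  have := h s hs.1
  rw [hs0] at this
  nlinarith

/-- The derivative `(u v)' = v² + q u²` is nonnegative whatever the signs of `u` and `v`. This in
turn makes `u²` and `v²` nondecreasing, since their derivatives are `2 u v` and `2 q u v`. -/
theorem mul_deriv_nonneg (h : IsSchrodingerSol q u v) (hq : ∀ t, 0 ≤ q t) (hu : 0 ≤ u α)
    (hv : 0 ≤ v α) {t : ℝ} (ht : α ≤ t) : 0 ≤ u t * v t := by
  have hm : MonotoneOn (fun t => u t * v t) (Ici α) :=
    monotoneOn_Ici (fun t => (h.deriv₁ t).mul (h.deriv₂ t)) fun t _ => by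
      nlinarith [mul_nonneg (hq t) (sq_nonneg (u t)), sq_nonneg (v t)]
  exact (mul_nonneg hu hv).trans (hm self_mem_Ici ht ht)

theorem deriv_pos (h : IsSchrodingerSol q u v) (hq : ∀ t, 0 ≤ q t) (hu : 0 ≤ u α)
    (hv : 0 < v α) {t : ℝ} (ht : α ≤ t) : 0 < v t := by
  refine pos_of_sq_ge h.continuous_deriv hv (fun t ht => ?_) ht
  exact monotoneOn_Ici (f := fun t => v t ^ 2) (fun t => (h.deriv₂ t).pow 2) (fun t ht => by
    have := mul_nonneg (hq t) (h.mul_deriv_nonneg hq hu hv.le ht)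
    norm_num
    nlinarith) self_mem_Ici ht ht

theorem pos (h : IsSchrodingerSol q u v) (hq : ∀ t, 0 ≤ q t) (hu : 0 < u α)
    (hv : 0 ≤ v α) {t : ℝ} (ht : α ≤ t) : 0 < u t := by
  refine pos_of_sq_ge h.continuous hu (fun t ht => ?_) ht
  exact monotoneOn_Ici (f := fun t => u t ^ 2) (fun t => (h.deriv₁ t).pow 2) (fun t ht => by
    have := h.mul_deriv_nonneg hq hu.le hv ht
    norm_num
    nlinarith) self_mem_Ici ht ht

/-- The solution with `u 0 = 0`, `u' 0 = 1` grows at least as fast as for `q = 0`. -/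
theorem growth (h : IsSchrodingerSol q u v) {δ : ℝ} (hδ : 0 < δ) (hq : ∀ t, δ ≤ q t)
    (hu : u 0 = 0) (hv : v 0 = 1) {t : ℝ} (ht : 0 ≤ t) :
    t ≤ u t ∧ 1 + δ * t ^ 2 / 2 ≤ v t := by
  have hq0 : ∀ t, 0 ≤ q t := fun t => hδ.le.trans (hq t)
  have hvp : ∀ t, 0 ≤ t → 0 < v t := fun t ht => h.deriv_pos hq0 hu.ge (by rw [hv]; norm_num) ht
  have hup : ∀ t, 0 ≤ t → 0 ≤ u t := fun t ht => by
    rw [← hu]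
    exact monotoneOn_Ici h.deriv₁ (fun t ht => (hvp t ht).le) self_mem_Ici ht ht
  have hv1 : ∀ t, 0 ≤ t → 1 ≤ v t := fun t ht => by
    rw [← hv]
    exact monotoneOn_Ici h.deriv₂ (fun t ht => mul_nonneg (hq0 t) (hup t ht)) self_mem_Ici ht ht
  have hut : ∀ t, 0 ≤ t → t ≤ u t := fun t ht => by
    have := monotoneOn_Ici (f := fun t => u t - t) (fun t => (h.deriv₁ t).sub (hasDerivAt_id t))
      (fun t ht => sub_nonneg.2 (hv1 t ht)) self_mem_Ici ht ht
    simp only [hu] at this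
    linarith
  refine ⟨hut t ht, ?_⟩
  -- From `u t ≥ t` follows `v' = q u ≥ δ t`. The resulting quadratic term is the source of the
  -- contraction factor `θ`.
  have hd : ∀ t, HasDerivAt (fun t => v t - δ * t ^ 2 / 2) (q t * u t - δ * t) t := fun t =>
    ((h.deriv₂ t).sub ((((hasDerivAt_id t).pow 2).const_mul δ).div_const 2)).congr_deriv
      (by simp; ring)
  have := monotoneOn_Ici hd (fun t ht => by
    have := mul_le_mul (hq t) (hut t ht) ht (hq0 t)
    linarith) self_mem_Ici ht ht
  simp only [hv] at this
  linarith

end Positivity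

/-! ### The half-line solution and the integral bound. -/

/-- The solution on a half-line that decays. -/
theorem exists_decaying {q : ℝ → ℝ} (hq : Continuous q) {δ : ℝ} (hδ : 0 < δ)
    (hqδ : ∀ t, δ ≤ q t) :
    ∃ u v, IsSchrodingerSol q u v ∧ u 0 = 1 ∧ v 0 < 0 ∧
      ∀ t, 0 ≤ t → 0 < u t ∧ v t ≤ 0 := by
  have hq0 : ∀ t, 0 ≤ q t := fun t => hδ.le.trans (hqδ t)
  obtain ⟨f, f', hf, hf0, hf'0⟩ := exists_sol hq 1 0
  obtain ⟨s, s', hs, hs0, hs'0⟩ := exists_sol hq 0 1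
  have hfp : ∀ t, 0 ≤ t → 0 < f t := fun t ht =>
    hf.pos hq0 (by rw [hf0]; norm_num) hf'0.ge ht
  have hsp : ∀ t, 0 < t → 0 < s t := fun t ht =>
    ht.trans_le (hs.growth hδ hqδ hs0 hs'0 ht.le).1
  have hW : ∀ t, f t * s' t - f' t * s t = 1 := fun t => by
    rw [hf.wronskian hs t 0, hf0, hs'0, hf'0, hs0]; norm_num
  have hd : ∀ t, 0 < t → HasDerivAt (fun t => f t / s t) (-1 / s t ^ 2) t := fun t ht =>
    ((hf.deriv₁ t).div (hs.deriv₁ t) (hsp t ht).ne').congr_deriv (by rw [← hW t]; ring)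
  have hanti : StrictAntiOn (fun t => f t / s t) (Ioi 0) := by
    refine strictAntiOn_of_deriv_neg (convex_Ioi 0)
      (fun t ht => (hd t ht).continuousAt.continuousWithinAt) fun t ht => ?_
    rw [interior_Ioi] at ht
    rw [(hd t ht).deriv]
    exact div_neg_of_neg_of_pos (by norm_num) (pow_pos (hsp t ht) 2)
  set S := (fun t => f t / s t) '' Ioi 0 with hS
  have hSb : BddBelow S := ⟨0, by
    rintro _ ⟨t, ht, rfl⟩
    exact (div_pos (hfp t (le_of_lt ht)) (hsp t ht)).le⟩
  -- `f - (f T / s T) s` is the solution vanishing at `T`. As `f / s` is strictly decreasing,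
  -- letting `T → ∞` leads to `f - m s`.
  set m := sInf S with hm
  have hmle : ∀ t, 0 < t → m ≤ f t / s t := fun t ht => csInf_le hSb ⟨t, ht, rfl⟩
  have hu := hf.lin_comb hs 1 (-m)
  -- If the slope were positive somewhere, then slightly later `f - m s` and its derivative would
  -- both be positive, and would stay so after subtracting a small `ε s`. Then `f - (m + ε) s` would
  -- remain positive, contradicting the choice of `m` as infimum.
  have hneg : ∀ t, 0 ≤ t → 1 * f' t + -m * s' t ≤ 0 := by
    intro t₁ ht₁
    by_contra! hcon
    have hut : 0 ≤ 1 * f t₁ + -m * s t₁ := by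
      rcases ht₁.eq_or_lt with rfl | h
      · rw [hf0, hs0]; norm_num
      · have := (le_div_iff₀ (hsp _ h)).1 (hmle _ h)
        linarith
    have hvp : ∀ t, t₁ ≤ t → 0 < 1 * f' t + -m * s' t := fun t ht => hu.deriv_pos hq0 hut hcon ht
    set t₂ := t₁ + 1 with ht₂
    have ht₂p : 0 < t₂ := by positivity
    have hu₂ : 0 < 1 * f t₂ + -m * s t₂ := by
      have hmono : StrictMonoOn (fun t => 1 * f t + -m * s t) (Ici t₁) :=
        strictMonoOn_of_deriv_pos (convex_Ici _) hu.continuous.continuousOn fun t ht => by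
          rw [interior_Ici] at ht
          rw [(hu.deriv₁ t).deriv]
          exact hvp t ht.le
      exact hut.trans_lt (hmono self_mem_Ici (by simp [ht₂]) (by simp [ht₂]))
    have hs'p : 0 < s' t₂ := by
      have := (hs.growth hδ hqδ hs0 hs'0 ht₂p.le).2
      have : 0 ≤ δ * t₂ ^ 2 / 2 := by positivity
      linarith
    have hv₂ := hvp t₂ (by simp [ht₂])
    obtain ⟨ε, hε, hε₁, hε₂⟩ : ∃ ε > 0, ε * s t₂ < 1 * f t₂ + -m * s t₂ ∧
        ε * s' t₂ < 1 * f' t₂ + -m * s' t₂ := by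
      refine ⟨min ((1 * f t₂ + -m * s t₂) / (2 * s t₂)) ((1 * f' t₂ + -m * s' t₂) / (2 * s' t₂)),
        lt_min (div_pos hu₂ (by linarith [hsp _ ht₂p])) (div_pos hv₂ (by linarith)), ?_, ?_⟩
      · refine (mul_le_mul_of_nonneg_right (min_le_left _ _) (hsp _ ht₂p).le).trans_lt ?_
        have := (hsp _ ht₂p).ne'
        rw [div_mul_eq_mul_div, mul_comm 2, ← div_div, mul_div_cancel_right₀ _ this]
        linarith
      · refine (mul_le_mul_of_nonneg_right (min_le_right _ _) hs'p.le).trans_lt ?_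
        rw [div_mul_eq_mul_div, mul_comm 2, ← div_div, mul_div_cancel_right₀ _ hs'p.ne']
        linarith
    have hlow : ∀ t, t₂ ≤ t → m + ε ≤ f t / s t := fun t ht => by
      have := (hf.lin_comb hs 1 (-(m + ε))).pos (α := t₂) hq0 (by linarith) (by linarith) ht
      rw [le_div_iff₀ (hsp t (ht₂p.trans_le ht))]
      linarith
    have : m + ε ≤ m := by
      refine le_csInf ⟨_, 1, by simp, rfl⟩ ?_
      rintro _ ⟨t, ht, rfl⟩
      rcases le_total t₂ t with h | h
      · exact hlow t h
      · exact (hlow t₂ le_rfl).trans (hanti.antitoneOn ht ht₂p h)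
    linarith
  have hpos : ∀ t, 0 < t → 0 < 1 * f t + -m * s t := fun t ht => by
    have h1 := (hmle (t + 1) (by positivity)).trans_lt
      (hanti (mem_Ioi.2 ht) (mem_Ioi.2 (by positivity : 0 < t + 1)) (by linarith))
    have := (lt_div_iff₀ (hsp t ht)).1 h1
    linarith
  -- The slope at `0` is `-m`. If `m ≤ 0`, then `f' - m s'` would be positive at `1`.
  have hm0 : 0 < m := by
    have h1 := hneg 1 zero_le_one
    by_contra! hm0
    have hf'p : 0 < f' 1 := by
      have hmono : StrictMonoOn f' (Ici 0) :=
        strictMonoOn_of_deriv_pos (convex_Ici _) hf.continuous_deriv.continuousOn fun t ht => by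
          rw [interior_Ici] at ht
          rw [(hf.deriv₂ t).deriv]
          exact mul_pos (hδ.trans_le (hqδ t)) (hfp t ht.le)
      simpa [hf'0] using hmono self_mem_Ici (mem_Ici.2 zero_le_one) zero_lt_one
    have hs'p := (hs.growth hδ hqδ hs0 hs'0 zero_le_one).2
    nlinarith [mul_nonneg (neg_nonneg.2 hm0) (by linarith : 0 ≤ s' 1)]
  refine ⟨_, _, hu, by rw [hf0, hs0]; norm_num, by rw [hf'0, hs'0]; linarith, fun t ht =>
    ⟨?_, hneg t ht⟩⟩
  rcases ht.eq_or_lt with rfl | h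
  · rw [hf0, hs0]; norm_num
  · exact hpos t h

/-- A solution of `u'' = q u` with `q ≥ δ` has integral at most `δ⁻¹` times the increase of `u'`. -/
theorem lintegral_le (h : IsSchrodingerSol q u v) (hqc : Continuous q) {δ : ℝ} (hδ : 0 < δ)
    (hq : ∀ t, δ ≤ q t) {T : ℝ} (hT : 0 ≤ T) (hu : ∀ t ∈ Ioc 0 T, 0 ≤ u t) :
    ∫⁻ t in Ioc 0 T, ENNReal.ofReal (u t) ≤ ENNReal.ofReal ((v T - v 0) / δ) := by
  have hi : IntervalIntegrable u volume 0 T := h.continuous.intervalIntegrable _ _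
  have hqi : IntervalIntegrable (fun t => q t * u t) volume 0 T :=
    (hqc.mul h.continuous).intervalIntegrable _ _
  rw [← ofReal_integral_eq_lintegral_ofReal (hi.1)
    ((ae_restrict_iff' measurableSet_Ioc).2 (ae_of_all _ hu))]
  refine ENNReal.ofReal_le_ofReal ?_
  rw [le_div_iff₀ hδ, ← intervalIntegral.integral_eq_sub_of_hasDerivAt (fun t _ => h.deriv₂ t) hqi,
    ← intervalIntegral.integral_of_le hT, mul_comm, ← intervalIntegral.integral_const_mul,
    intervalIntegral.integral_of_le hT, intervalIntegral.integral_of_le hT]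
  exact setIntegral_mono_on (hi.const_mul δ).1 hqi.1 measurableSet_Ioc
    fun t ht => mul_le_mul_of_nonneg_right (hq t) (hu t ht)

end IsSchrodingerSol

/-! ### Fundamental solutions on an edge. -/

/-- Fundamental solutions of `u'' = q u` on an edge of length `ℓ`: `u₀` is `1` at the start and
vanishes at the end (decays, if `ℓ = ∞`), `u₁` vanishes at the start and is `1` at the end
(is positive, if `ℓ = ∞`). The numbers `-a₀, b, a₁` are the entries of the Dirichlet-to-Neumann
map. -/
structure EdgeProfile (q : ℝ → ℝ) (ℓ : ℝ≥0∞) (δ θ : ℝ) where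
  u₀ : ℝ → ℝ
  v₀ : ℝ → ℝ
  u₁ : ℝ → ℝ
  v₁ : ℝ → ℝ
  a₀ : ℝ
  a₁ : ℝ
  b : ℝ
  sol₀ : IsSchrodingerSol q u₀ v₀
  sol₁ : IsSchrodingerSol q u₁ v₁
  u₀_zero : u₀ 0 = 1
  v₀_zero : v₀ 0 = -a₀
  u₁_zero : u₁ 0 = 0
  v₁_zero : v₁ 0 = b
  b_pos : 0 < b
  b_le₀ : b ≤ θ * a₀
  u₀_pos : ∀ t, 0 < t → ENNReal.ofReal t < ℓ → 0 < u₀ t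
  u₀_le : ∀ t, 0 < t → ENNReal.ofReal t < ℓ → u₀ t ≤ 1
  u₁_pos : ∀ t, 0 < t → ENNReal.ofReal t < ℓ → 0 < u₁ t
  lintegral₀ : ∫⁻ t in {t | 0 < t ∧ ENNReal.ofReal t < ℓ}, ENNReal.ofReal (u₀ t)
    ≤ ENNReal.ofReal (a₀ / δ)
  u₀_len : ℓ ≠ ∞ → u₀ ℓ.toReal = 0
  v₀_len : ℓ ≠ ∞ → v₀ ℓ.toReal = -b
  u₁_len : ℓ ≠ ∞ → u₁ ℓ.toReal = 1
  v₁_len : ℓ ≠ ∞ → v₁ ℓ.toReal = a₁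
  b_le₁ : ℓ ≠ ∞ → b ≤ θ * a₁
  u₁_le : ℓ ≠ ∞ → ∀ t, 0 < t → ENNReal.ofReal t < ℓ → u₁ t ≤ 1
  lintegral₁ : ℓ ≠ ∞ → ∫⁻ t in {t | 0 < t ∧ ENNReal.ofReal t < ℓ}, ENNReal.ofReal (u₁ t)
    ≤ ENNReal.ofReal (a₁ / δ)
  a₁_top : ℓ = ∞ → a₁ = 0

theorem ofReal_lt_iff_lt_toReal {ℓ : ℝ≥0∞} (hℓ : ℓ ≠ ∞) {t : ℝ} (ht : 0 < t) :
    ENNReal.ofReal t < ℓ ↔ t < ℓ.toReal := by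
  rw [← ENNReal.ofReal_toReal hℓ, ENNReal.toReal_ofReal ENNReal.toReal_nonneg]
  exact ENNReal.ofReal_lt_ofReal_iff' |>.trans ⟨fun h => h.1, fun h => ⟨h, ht.trans h⟩⟩

theorem setOf_lt_subset_Ioc {ℓ : ℝ≥0∞} (hℓ : ℓ ≠ ∞) :
    {t : ℝ | 0 < t ∧ ENNReal.ofReal t < ℓ} ⊆ Ioc 0 ℓ.toReal :=
  fun _ ht => ⟨ht.1, ((ofReal_lt_iff_lt_toReal hℓ ht.1).1 ht.2).le⟩

theorem EdgeProfile.nonempty_of_ne_top {q : ℝ → ℝ} (hq : Continuous q) {δ : ℝ} (hδ : 0 < δ)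
    (hqδ : ∀ t, δ ≤ q t) {m : ℝ} (hm : 0 < m) {ℓ : ℝ≥0∞} (hmℓ : ENNReal.ofReal m ≤ ℓ)
    (hℓ : ℓ ≠ ∞) : Nonempty (EdgeProfile q ℓ δ (1 + δ * m ^ 2 / 2)⁻¹) := by
  set L := ℓ.toReal with hL
  have hmL : m ≤ L := (ENNReal.ofReal_le_iff_le_toReal hℓ).1 hmℓ
  have hL0 : 0 < L := hm.trans_le hmL
  obtain ⟨s, s', hs, hs0, hs'0⟩ := IsSchrodingerSol.exists_sol hq 0 1
  -- Solving for the reflected potential makes `t ↦ r (L - t)` a solution vanishing at the far end.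
  -- Then `u₀` and `u₁` are `r (L - t) / r L` and `s t / s L`.
  obtain ⟨r, r', hr, hr0, hr'0⟩ :=
    IsSchrodingerSol.exists_sol (q := fun t => q (L - t)) (by fun_prop) 0 1
  have gs := fun t (ht : 0 ≤ t) => hs.growth hδ hqδ hs0 hs'0 ht
  have gr := fun t (ht : 0 ≤ t) => hr.growth hδ (fun t => hqδ _) hr0 hr'0 ht
  have one_le : ∀ t : ℝ, 1 ≤ 1 + δ * t ^ 2 / 2 := fun t => by
    have : 0 ≤ δ * t ^ 2 / 2 := by positivity
    linarith
  have hs' : ∀ t, 0 ≤ t → 0 ≤ s' t := fun t ht =>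
    zero_le_one.trans ((one_le t).trans (gs t ht).2)
  have hr' : ∀ t, 0 ≤ t → 0 ≤ r' t := fun t ht =>
    zero_le_one.trans ((one_le t).trans (gr t ht).2)
  have hsL : 0 < s L := hL0.trans_le (gs L hL0.le).1
  have hrL : 0 < r L := hL0.trans_le (gr L hL0.le).1
  have hmθ : 1 + δ * m ^ 2 / 2 ≤ 1 + δ * L ^ 2 / 2 := by gcongr
  have hr₀ := hr.reverse
  -- Comparing the Wronskian at the two ends yields `r L = s L`. The Dirichlet-to-Neumann map is
  -- therefore symmetric, and one number `b` serves both ends.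
  have hW := hr₀.wronskian hs 0 L
  simp only [sub_zero, sub_self, hs0, hs'0, hr0, hr'0, mul_one, mul_zero, zero_mul, neg_mul,
    one_mul, sub_neg_eq_add, zero_add] at hW
  have sol₀ := hr₀.const_mul (r L)⁻¹
  have sol₁ := hs.const_mul (s L)⁻¹
  have hθ : 0 < 1 + δ * m ^ 2 / 2 := zero_lt_one.trans_le (one_le m)
  have pos₀ : ∀ t, 0 < t → ENNReal.ofReal t < ℓ → 0 < (r L)⁻¹ * r (L - t) := fun t ht htl => by
    have := (ofReal_lt_iff_lt_toReal hℓ ht).1 htl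
    exact mul_pos (inv_pos.2 hrL) ((sub_pos.2 this).trans_le (gr _ (sub_pos.2 this).le).1)
  have pos₁ : ∀ t, 0 < t → 0 < (s L)⁻¹ * s t := fun t ht =>
    mul_pos (inv_pos.2 hsL) (ht.trans_le (gs _ ht.le).1)
  -- Here `b = 1 / s L`, while `a₀` and `a₁` are `r' L / s L` and `s' L / s L`. The growth bound
  -- makes both numerators at least `θ⁻¹`.
  have key : ∀ x : ℝ, 1 + δ * L ^ 2 / 2 ≤ x →
      (s L)⁻¹ ≤ (1 + δ * m ^ 2 / 2)⁻¹ * ((s L)⁻¹ * x) := fun x hx => by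
    rw [mul_left_comm]
    refine le_mul_of_one_le_right (inv_pos.2 hsL).le ?_
    rw [← div_eq_inv_mul, one_le_div hθ]
    exact hmθ.trans hx
  exact ⟨{
    u₀ := _, v₀ := _, u₁ := _, v₁ := _
    a₀ := (r L)⁻¹ * r' L, a₁ := (s L)⁻¹ * s' L, b := (s L)⁻¹
    sol₀ := sol₀, sol₁ := sol₁
    u₀_zero := by simp [hrL.ne']
    v₀_zero := by simp
    u₁_zero := by simp [hs0]
    v₁_zero := by simp [hs'0]
    b_pos := inv_pos.2 hsL
    b_le₀ := by rw [hW]; exact key _ (gr L hL0.le).2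
    u₀_pos := pos₀
    u₀_le := fun t ht htl => by
      have := (ofReal_lt_iff_lt_toReal hℓ ht).1 htl
      rw [← div_eq_inv_mul, div_le_one hrL]
      exact IsSchrodingerSol.monotoneOn_Ici hr.deriv₁ hr' (sub_pos.2 this).le hL0.le
        (sub_le_self _ ht.le)
    u₁_pos := fun t ht _ => pos₁ t ht
    lintegral₀ := by
      refine (lintegral_mono_set (setOf_lt_subset_Ioc hℓ)).trans
        ((sol₀.lintegral_le hq hδ hqδ hL0.le fun t ht => ?_).trans (ENNReal.ofReal_le_ofReal ?_))
      · exact mul_nonneg (inv_pos.2 hrL).le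
          ((sub_nonneg.2 ht.2).trans (gr _ (sub_nonneg.2 ht.2)).1)
      · gcongr
        simp [hr'0, hrL.le]
    u₀_len := fun _ => by simp [← hL, hr0]
    v₀_len := fun _ => by simp [← hL, hr'0, hW]
    u₁_len := fun _ => by simp [← hL, hsL.ne']
    v₁_len := fun _ => rfl
    b_le₁ := fun _ => key _ (gs L hL0.le).2
    u₁_le := fun _ t ht htl => by
      have := (ofReal_lt_iff_lt_toReal hℓ ht).1 htl
      rw [← div_eq_inv_mul, div_le_one hsL]
      exact IsSchrodingerSol.monotoneOn_Ici hs.deriv₁ hs' ht.le hL0.le this.le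
    lintegral₁ := fun _ => by
      refine (lintegral_mono_set (setOf_lt_subset_Ioc hℓ)).trans
        ((sol₁.lintegral_le hq hδ hqδ hL0.le fun t ht => (pos₁ t ht.1).le).trans
          (ENNReal.ofReal_le_ofReal ?_))
      gcongr
      simp [hs'0, hsL.le]
    a₁_top := fun h => (hℓ h).elim }⟩

theorem lintegral_Ioi_le_of_forall_Ioc {f : ℝ → ℝ≥0∞} {C : ℝ≥0∞}
    (h : ∀ T : ℝ, 0 ≤ T → ∫⁻ t in Ioc 0 T, f t ≤ C) : ∫⁻ t in Ioi (0 : ℝ), f t ≤ C := by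
  have hU : Ioi (0 : ℝ) = ⋃ n : ℕ, Ioc 0 (n : ℝ) := (iUnion_Ioc_eq_Ioi_self_iff.2 fun x _ =>
    exists_nat_ge x).symm
  rw [hU, setLIntegral_iUnion_of_directed _ (Monotone.directed_le fun m n hmn =>
    Ioc_subset_Ioc_right (Nat.cast_le.2 hmn))]
  exact iSup_le fun n => h n n.cast_nonneg

theorem EdgeProfile.nonempty_top {q : ℝ → ℝ} (hq : Continuous q) {δ : ℝ} (hδ : 0 < δ)
    (hqδ : ∀ t, δ ≤ q t) {θ : ℝ} (hθ : 0 < θ) : Nonempty (EdgeProfile q ∞ δ θ) := by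
  obtain ⟨f, f', hf, hf0, hf'0, hpos⟩ := IsSchrodingerSol.exists_decaying hq hδ hqδ
  obtain ⟨s, s', hs, hs0, hs'0⟩ := IsSchrodingerSol.exists_sol hq 0 1
  -- With no far end to normalize `u₁`, its slope `b` is free, and this choice turns `b ≤ θ a₀` into
  -- an equality. The value `a₁ = 0` keeps the absent end out of all sums.
  have hb : 0 < θ * -f' 0 := mul_pos hθ (neg_pos.2 hf'0)
  exact ⟨{
    u₀ := f, v₀ := f', u₁ := _, v₁ := _
    a₀ := -f' 0, a₁ := 0, b := θ * -f' 0
    sol₀ := hf, sol₁ := hs.const_mul (θ * -f' 0)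
    u₀_zero := hf0
    v₀_zero := by simp
    u₁_zero := by simp [hs0]
    v₁_zero := by simp [hs'0]
    b_pos := hb
    b_le₀ := le_rfl
    u₀_pos := fun t ht _ => (hpos t ht.le).1
    u₀_le := fun t ht _ => by
      have := IsSchrodingerSol.monotoneOn_Ici (α := 0) (fun t => (hf.deriv₁ t).neg)
        (fun t ht => neg_nonneg.2 (hpos t ht).2) self_mem_Ici ht.le ht.le
      simp only [Pi.neg_apply, hf0] at this
      linarith
    u₁_pos := fun t ht _ => mul_pos hb (ht.trans_le (hs.growth hδ hqδ hs0 hs'0 ht.le).1)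
    lintegral₀ := by
      have : {t : ℝ | 0 < t ∧ ENNReal.ofReal t < ∞} = Ioi 0 := by ext; simp
      rw [this]
      refine lintegral_Ioi_le_of_forall_Ioc fun T hT =>
        (hf.lintegral_le hq hδ hqδ hT fun t ht => (hpos t ht.1.le).1.le).trans
          (ENNReal.ofReal_le_ofReal ?_)
      gcongr
      linarith [(hpos T hT).2]
    u₀_len := fun h => (h rfl).elim
    v₀_len := fun h => (h rfl).elim
    u₁_len := fun h => (h rfl).elim
    v₁_len := fun h => (h rfl).elim
    b_le₁ := fun h => (h rfl).elim
    u₁_le := fun h => (h rfl).elim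
    lintegral₁ := fun h => (h rfl).elim
    a₁_top := fun _ => rfl }⟩

theorem EdgeProfile.nonempty {q : ℝ → ℝ} (hq : Continuous q) {δ : ℝ} (hδ : 0 < δ)
    (hqδ : ∀ t, δ ≤ q t) {m : ℝ} (hm : 0 < m) {ℓ : ℝ≥0∞} (hmℓ : ENNReal.ofReal m ≤ ℓ) :
    Nonempty (EdgeProfile q ℓ δ (1 + δ * m ^ 2 / 2)⁻¹) := by
  by_cases hℓ : ℓ = ∞
  · subst hℓ
    exact EdgeProfile.nonempty_top hq hδ hqδ (by positivity)
  · exact EdgeProfile.nonempty_of_ne_top hq hδ hqδ hm hmℓ hℓ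

/-! ### Sums over edge ends. -/

namespace MetricGraph

variable {Vert Edge : Type*} (Γ : MetricGraph Vert Edge)

/-- The function on the edge ends at `v` given by `F₀` at starts and `F₁` at ends of edges. -/
def endVal {R : Type*} (F₀ F₁ : Edge → R) {v : Vert} : Γ.EdgeEnd v → R
  | .inl e => F₀ e.1
  | .inr e => F₁ e.1

theorem endVal_ne_top {F₀ F₁ : Edge → ℝ≥0∞} (h₀ : ∀ e, F₀ e ≠ ∞) (h₁ : ∀ e, F₁ e ≠ ∞) {v : Vert}
    (a : Γ.EdgeEnd v) : Γ.endVal F₀ F₁ a ≠ ∞ :=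
  match a with
  | .inl e => h₀ e.1
  | .inr e => h₁ e.1

/-- The sum over the edge ends at `v`, of `F₀` at starts and `F₁` at ends of edges. -/
noncomputable def endSum (F₀ F₁ : Edge → ℝ≥0∞) (v : Vert) : ℝ≥0∞ :=
  ∑' a : Γ.EdgeEnd v, Γ.endVal F₀ F₁ a

theorem endSum_eq (F₀ F₁ : Edge → ℝ≥0∞) (v : Vert) :
    Γ.endSum F₀ F₁ v =
      (∑' e : {e : Edge // Γ.src e = v}, F₀ e) +
        ∑' e : {e : Edge // Γ.len e ≠ ∞ ∧ Γ.tgt e = v}, F₁ e :=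
  Summable.tsum_sum (α := {e : Edge // Γ.src e = v})
    (β := {e : Edge // Γ.len e ≠ ∞ ∧ Γ.tgt e = v}) (f := Γ.endVal F₀ F₁)
    ENNReal.summable ENNReal.summable

theorem endSum_mono {F₀ F₁ G₀ G₁ : Edge → ℝ≥0∞} (h₀ : ∀ e, F₀ e ≤ G₀ e)
    (h₁ : ∀ e, Γ.len e ≠ ∞ → F₁ e ≤ G₁ e) (v : Vert) : Γ.endSum F₀ F₁ v ≤ Γ.endSum G₀ G₁ v :=
  ENNReal.tsum_le_tsum fun a => match a with
    | .inl e => h₀ e.1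
    | .inr e => h₁ e.1 e.2.1

theorem mul_endSum (x : ℝ≥0∞) (F₀ F₁ : Edge → ℝ≥0∞) (v : Vert) :
    x * Γ.endSum F₀ F₁ v = Γ.endSum (fun e => x * F₀ e) (fun e => x * F₁ e) v := by
  rw [endSum, ← ENNReal.tsum_mul_left]
  exact tsum_congr fun a => match a with
    | .inl e => rfl
    | .inr e => rfl

theorem endSum_tsum (F₀ F₁ : ℕ → Edge → ℝ≥0∞) (v : Vert) :
    Γ.endSum (fun e => ∑' n, F₀ n e) (fun e => ∑' n, F₁ n e) v =
      ∑' n, Γ.endSum (F₀ n) (F₁ n) v := by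
  unfold endSum
  rw [ENNReal.tsum_comm]
  exact tsum_congr fun a => match a with
    | .inl e => rfl
    | .inr e => rfl

theorem endSum_add (F₀ F₁ G₀ G₁ : Edge → ℝ≥0∞) (v : Vert) :
    Γ.endSum (fun e => F₀ e + G₀ e) (fun e => F₁ e + G₁ e) v =
      Γ.endSum F₀ F₁ v + Γ.endSum G₀ G₁ v := by
  rw [endSum, endSum, endSum, ← ENNReal.tsum_add]
  exact tsum_congr fun a => match a with
    | .inl e => rfl
    | .inr e => rfl

/-- Double counting of edge ends, by vertex and by edge. On a half-line `tgt e` is meaningless, so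
`F₁` must vanish there. -/
theorem tsum_mul_endSum (x : Vert → ℝ≥0∞) (F₀ F₁ : Edge → ℝ≥0∞) (h : ∀ e, Γ.len e = ∞ → F₁ e = 0) :
    ∑' v, x v * Γ.endSum F₀ F₁ v = ∑' e, (x (Γ.src e) * F₀ e + x (Γ.tgt e) * F₁ e) := by
  classical
  simp only [endSum_eq, mul_add]
  rw [ENNReal.tsum_add, ENNReal.tsum_add]
  congr 1
  · rw [← (Equiv.sigmaFiberEquiv Γ.src).tsum_eq, ENNReal.tsum_sigma']
    refine tsum_congr fun v => ?_
    rw [← ENNReal.tsum_mul_left]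
    exact tsum_congr fun ⟨e, he⟩ => by subst he; rfl
  · rw [← (Equiv.sigmaFiberEquiv Γ.tgt).tsum_eq, ENNReal.tsum_sigma']
    refine tsum_congr fun v => ?_
    have h1 := tsum_subtype {e : Edge | Γ.len e ≠ ∞ ∧ Γ.tgt e = v} F₁
    have h2 := tsum_subtype {e : Edge | Γ.tgt e = v} F₁
    have h3 : ∑' e : {e : Edge // Γ.len e ≠ ∞ ∧ Γ.tgt e = v}, F₁ e =
        ∑' e : {e : Edge // Γ.tgt e = v}, F₁ e := by
      refine h1.trans (Eq.trans (tsum_congr fun e => ?_) h2.symm)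
      by_cases he : Γ.len e = ∞
      · simp [indicator, h e he]
      · simp [indicator, he]
    rw [h3, ← ENNReal.tsum_mul_left]
    exact tsum_congr fun ⟨e, he⟩ => by subst he; rfl

/-! ### Solving the vertex equations. -/

section Neumann

variable (a₀ a₁ c k₀ k₁ : Edge → ℝ≥0∞)

/-- The terms of the Neumann series for the vertex equations. -/
noncomputable def neumann : ℕ → Vert → ℝ≥0∞
  | 0 => fun v => (Γ.endSum a₀ a₁ v)⁻¹ * Γ.endSum k₀ k₁ v
  | n + 1 => fun v => (Γ.endSum a₀ a₁ v)⁻¹ * Γ.endSum (fun e => c e * neumann n (Γ.tgt e))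
      (fun e => c e * neumann n (Γ.src e)) v

variable {a₀ a₁ c k₀ k₁}

/-- The vertex equations have a nonnegative, bounded and integrable solution. -/
theorem exists_vertex_solution_ennreal (hfin : Γ.LocallyFinite) {θ : ℝ≥0∞} (hθ : θ < 1)
    (ha₀ : ∀ e, a₀ e ≠ 0 ∧ a₀ e ≠ ∞) (ha₁ : ∀ e, a₁ e ≠ ∞)
    (ha₁0 : ∀ e, Γ.len e ≠ ∞ → a₁ e ≠ 0)
    (hc₀ : ∀ e, c e ≤ θ * a₀ e) (hc₁ : ∀ e, Γ.len e ≠ ∞ → c e ≤ θ * a₁ e)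
    (hc : ∀ e, Γ.len e = ∞ → c e = 0) (hk₁ : ∀ e, Γ.len e = ∞ → k₁ e = 0)
    (hatop : ∀ e, Γ.len e = ∞ → a₁ e = 0)
    {K : ℝ≥0∞} (hK : K ≠ ∞) (hkK₀ : ∀ e, k₀ e ≤ K * a₀ e) (hkK₁ : ∀ e, Γ.len e ≠ ∞ → k₁ e ≤ K * a₁ e)
    (hks : ∑' e, (k₀ e + k₁ e) ≠ ∞) :
    ∃ x : Vert → ℝ≥0∞, ∃ M ≠ ∞, (∀ v, x v ≤ M) ∧
      (∀ v, Γ.endSum a₀ a₁ v * x v =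
        Γ.endSum (fun e => c e * x (Γ.tgt e) + k₀ e) (fun e => c e * x (Γ.src e) + k₁ e) v) ∧
      ∑' e, (x (Γ.src e) * a₀ e + x (Γ.tgt e) * a₁ e) ≠ ∞ := by
  set A := Γ.endSum a₀ a₁ with hA
  obtain ⟨T, hT0, hTs⟩ : ∃ T : ℕ → Vert → ℝ≥0∞,
      (∀ v, T 0 v = (A v)⁻¹ * Γ.endSum k₀ k₁ v) ∧
      ∀ n v, T (n + 1) v = (A v)⁻¹ * Γ.endSum (fun e => c e * T n (Γ.tgt e))
        (fun e => c e * T n (Γ.src e)) v :=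
    ⟨Γ.neumann a₀ a₁ c k₀ k₁, fun _ => rfl, fun _ _ => rfl⟩
  have hAtop : ∀ v, A v ≠ ∞ := fun v => by
    have := hfin v
    have := Fintype.ofFinite (Γ.EdgeEnd v)
    rw [hA, endSum, tsum_fintype]
    exact ENNReal.sum_ne_top.2 fun a _ => Γ.endVal_ne_top (fun e => (ha₀ e).2) ha₁ a
  -- If `A v = 0`, then no edge ends at `v`, and both sides are empty sums.
  have hAmul : ∀ v F₀ F₁, A v * ((A v)⁻¹ * Γ.endSum F₀ F₁ v) = Γ.endSum F₀ F₁ v := by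
    intro v F₀ F₁
    by_cases h0 : A v = 0
    · rw [hA, endSum, ENNReal.tsum_eq_zero] at h0
      have : IsEmpty (Γ.EdgeEnd v) :=
        ⟨fun a => match a with
          | .inl e => (ha₀ e.1).1 (h0 (.inl e))
          | .inr e => ha₁0 e.1 e.2.1 (h0 (.inr e))⟩
      simp [endSum]
    · rw [← mul_assoc, ENNReal.mul_inv_cancel h0 (hAtop v), one_mul]
  -- Row sums: at each edge end of `v`, `c` is at most `θ` times the coefficient `a` of that same
  -- end.
  have hsup : ∀ n v, T n v ≤ K * θ ^ n := by
    intro n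
    induction n with
    | zero =>
      intro v
      calc T 0 v = (A v)⁻¹ * Γ.endSum k₀ k₁ v := hT0 v
        _ ≤ (A v)⁻¹ * (K * A v) := by
          gcongr; rw [hA, mul_endSum]; exact Γ.endSum_mono hkK₀ hkK₁ v
        _ = K * ((A v)⁻¹ * A v) := by ring
        _ ≤ K * 1 := by gcongr; exact ENNReal.inv_mul_le_one _
        _ = K * θ ^ 0 := by simp
    | succ n ih =>
      intro v
      calc T (n + 1) v = (A v)⁻¹ * Γ.endSum (fun e => c e * T n (Γ.tgt e))
            (fun e => c e * T n (Γ.src e)) v := hTs n v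
        _ ≤ (A v)⁻¹ * (K * θ ^ (n + 1) * A v) := by
          gcongr
          rw [hA, mul_endSum]
          refine Γ.endSum_mono (fun e => ?_) (fun e he => ?_) v
          · refine (mul_le_mul' (hc₀ e) (ih _)).trans_eq ?_
            ring
          · refine (mul_le_mul' (hc₁ e he) (ih _)).trans_eq ?_
            ring
        _ = K * θ ^ (n + 1) * ((A v)⁻¹ * A v) := by ring
        _ ≤ K * θ ^ (n + 1) * 1 := by gcongr; exact ENNReal.inv_mul_le_one _
        _ = K * θ ^ (n + 1) := mul_one _
  have hA1 : ∀ x : Vert → ℝ≥0∞, ∑' v, x v * A v =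
      ∑' e, (x (Γ.src e) * a₀ e + x (Γ.tgt e) * a₁ e) := fun x =>
    Γ.tsum_mul_endSum x a₀ a₁ hatop
  -- Column sums: the term `c * T n (tgt e)`, collected at `src e`, is charged to the coefficient
  -- `a₁` at `tgt e`, and vice versa. This needs `c ≤ θ a` at both ends.
  have hl1 : ∀ n, ∑' v, T n v * A v ≤ (∑' e, (k₀ e + k₁ e)) * θ ^ n := by
    intro n
    induction n with
    | zero =>
      calc ∑' v, T 0 v * A v = ∑' v, 1 * Γ.endSum k₀ k₁ v := tsum_congr fun v => by
            rw [mul_comm, one_mul, hT0, hAmul]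
        _ = (∑' e, (k₀ e + k₁ e)) * θ ^ 0 := by
          rw [Γ.tsum_mul_endSum (fun _ => 1) k₀ k₁ hk₁]; simp
        _ ≤ (∑' e, (k₀ e + k₁ e)) * θ ^ 0 := le_rfl
    | succ n ih =>
      calc ∑' v, T (n + 1) v * A v = ∑' v, 1 * Γ.endSum (fun e => c e * T n (Γ.tgt e))
            (fun e => c e * T n (Γ.src e)) v := tsum_congr fun v => by
            rw [mul_comm, one_mul, hTs, hAmul]
        _ = ∑' e, (c e * T n (Γ.tgt e) + c e * T n (Γ.src e)) := by
          rw [Γ.tsum_mul_endSum (fun _ => 1) _ _ fun e he => by rw [hc e he, zero_mul]]; simp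
        _ ≤ ∑' e, θ * (T n (Γ.src e) * a₀ e + T n (Γ.tgt e) * a₁ e) := by
          refine ENNReal.tsum_le_tsum fun e => ?_
          by_cases he : Γ.len e = ∞
          · simp [hc e he]
          · calc c e * T n (Γ.tgt e) + c e * T n (Γ.src e)
                ≤ θ * a₁ e * T n (Γ.tgt e) + θ * a₀ e * T n (Γ.src e) := by
                  exact add_le_add (mul_le_mul_left (hc₁ e he) _) (mul_le_mul_left (hc₀ e) _)
              _ = θ * (T n (Γ.src e) * a₀ e + T n (Γ.tgt e) * a₁ e) := by ring
        _ = θ * ∑' v, T n v * A v := by rw [ENNReal.tsum_mul_left, hA1]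
        _ ≤ θ * ((∑' e, (k₀ e + k₁ e)) * θ ^ n) := mul_le_mul_right ih θ
        _ = (∑' e, (k₀ e + k₁ e)) * θ ^ (n + 1) := by ring
  have hgeo : ∑' n : ℕ, θ ^ n ≠ ∞ := by
    rw [ENNReal.tsum_geometric]
    exact ENNReal.inv_ne_top.2 (tsub_pos_of_lt hθ).ne'
  refine ⟨fun v => ∑' n, T n v, K * ∑' n : ℕ, θ ^ n, ENNReal.mul_ne_top hK hgeo, fun v => ?_,
    fun v => ?_, ?_⟩
  · rw [← ENNReal.tsum_mul_left]
    exact ENNReal.tsum_le_tsum fun n => hsup n v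
  · beta_reduce
    have h0 : A v * T 0 v = Γ.endSum k₀ k₁ v := by rw [hT0, hAmul]
    have h1 : ∀ n, A v * T (n + 1) v = Γ.endSum (fun e => c e * T n (Γ.tgt e))
        (fun e => c e * T n (Γ.src e)) v := fun n => by rw [hTs, hAmul]
    rw [endSum_add, tsum_eq_zero_add' ENNReal.summable, mul_add, h0, add_comm,
      ← ENNReal.tsum_mul_left]
    simp only [h1, ← endSum_tsum, ENNReal.tsum_mul_left]
  · beta_reduce
    rw [← hA1 fun v => ∑' n, T n v]
    simp only [← ENNReal.tsum_mul_right]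
    rw [ENNReal.tsum_comm]
    refine ne_top_of_le_ne_top (ENNReal.mul_ne_top hks hgeo)
      ((ENNReal.tsum_le_tsum hl1).trans_eq ENNReal.tsum_mul_left)

end Neumann

/-- The vertex equations have a nonnegative, bounded and integrable solution. -/
theorem exists_vertex_solution (hfin : Γ.LocallyFinite) {θ : ℝ} (hθ0 : 0 ≤ θ) (hθ : θ < 1)
    {a₀ a₁ c k₀ k₁ : Edge → ℝ} (ha₀ : ∀ e, 0 < a₀ e)
    (ha₁ : ∀ e, Γ.len e ≠ ∞ → 0 < a₁ e) (hatop : ∀ e, Γ.len e = ∞ → a₁ e = 0)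
    (hc : ∀ e, 0 ≤ c e) (hc₀ : ∀ e, c e ≤ θ * a₀ e) (hc₁ : ∀ e, Γ.len e ≠ ∞ → c e ≤ θ * a₁ e)
    (hctop : ∀ e, Γ.len e = ∞ → c e = 0)
    (hk₀ : ∀ e, 0 ≤ k₀ e) (hk₁ : ∀ e, 0 ≤ k₁ e)
    (hka₀ : ∀ e, k₀ e ≤ a₀ e) (hka₁ : ∀ e, Γ.len e ≠ ∞ → k₁ e ≤ a₁ e)
    (hktop : ∀ e, Γ.len e = ∞ → k₁ e = 0)
    {e₀ : Edge} (hk : ∀ e, e ≠ e₀ → k₀ e = 0 ∧ k₁ e = 0) :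
    ∃ x : Vert → ℝ, ∃ M : ℝ, (∀ v, 0 ≤ x v) ∧ (∀ v, x v ≤ M) ∧
      (∀ v, ∑ᶠ a : Γ.EdgeEnd v, Γ.endVal (fun e => c e * x (Γ.tgt e) + k₀ e - a₀ e * x (Γ.src e))
        (fun e => c e * x (Γ.src e) + k₁ e - a₁ e * x (Γ.tgt e)) a = 0) ∧
      ∑' e, (ENNReal.ofReal (x (Γ.src e) * a₀ e) + ENNReal.ofReal (x (Γ.tgt e) * a₁ e)) ≠ ∞ := by
  have ha₁' : ∀ e, 0 ≤ a₁ e := fun e => by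
    by_cases he : Γ.len e = ∞
    exacts [(hatop e he).ge, (ha₁ e he).le]
  obtain ⟨x, M, hM, hxM, hx, hs⟩ := Γ.exists_vertex_solution_ennreal hfin
    (a₀ := fun e => ENNReal.ofReal (a₀ e)) (a₁ := fun e => ENNReal.ofReal (a₁ e))
    (c := fun e => ENNReal.ofReal (c e)) (k₀ := fun e => ENNReal.ofReal (k₀ e))
    (k₁ := fun e => ENNReal.ofReal (k₁ e)) (θ := ENNReal.ofReal θ) (K := 1)
    (ENNReal.ofReal_lt_one.2 hθ)
    (fun e => ⟨(ENNReal.ofReal_pos.2 (ha₀ e)).ne', ENNReal.ofReal_ne_top⟩)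
    (fun e => ENNReal.ofReal_ne_top) (fun e he => (ENNReal.ofReal_pos.2 (ha₁ e he)).ne')
    (fun e => by rw [← ENNReal.ofReal_mul hθ0]; exact ENNReal.ofReal_le_ofReal (hc₀ e))
    (fun e he => by rw [← ENNReal.ofReal_mul hθ0]; exact ENNReal.ofReal_le_ofReal (hc₁ e he))
    (fun e he => by simp [hctop e he]) (fun e he => by simp [hktop e he])
    (fun e he => by simp [hatop e he]) ENNReal.one_ne_top
    (fun e => by rw [one_mul]; exact ENNReal.ofReal_le_ofReal (hka₀ e))
    (fun e he => by rw [one_mul]; exact ENNReal.ofReal_le_ofReal (hka₁ e he))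
    -- The source sits on the single edge `e₀`, so its total mass is finite.
    (by
      rw [tsum_eq_single e₀ fun e he => by simp [hk e he]]
      exact ENNReal.add_ne_top.2 ⟨ENNReal.ofReal_ne_top, ENNReal.ofReal_ne_top⟩)
  have hxt : ∀ v, x v ≠ ∞ := fun v => ne_top_of_le_ne_top hM (hxM v)
  have hxr : ∀ v, x v = ENNReal.ofReal (x v).toReal := fun v => (ENNReal.ofReal_toReal (hxt v)).symm
  refine ⟨fun v => (x v).toReal, M.toReal, fun v => ENNReal.toReal_nonneg,
    fun v => ENNReal.toReal_mono hM (hxM v), fun v => ?_, ?_⟩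
  · have := hfin v
    have := Fintype.ofFinite (Γ.EdgeEnd v)
    have h := hx v
    simp only [endSum, tsum_fintype] at h
    rw [Finset.sum_mul] at h
    have h' := congrArg ENNReal.toReal h
    rw [ENNReal.toReal_sum, ENNReal.toReal_sum, ← sub_eq_zero, ← neg_eq_zero, neg_sub,
      ← Finset.sum_sub_distrib] at h'
    · rw [finsum_eq_sum_of_fintype, ← h']
      refine Finset.sum_congr rfl fun a _ => ?_
      match a with
      | .inl e =>
        have he := e.2
        simp only [endVal, he]
        rw [ENNReal.toReal_add (ENNReal.mul_ne_top ENNReal.ofReal_ne_top (hxt _))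
          ENNReal.ofReal_ne_top, ENNReal.toReal_mul, ENNReal.toReal_mul,
          ENNReal.toReal_ofReal (hc _), ENNReal.toReal_ofReal (hk₀ _),
          ENNReal.toReal_ofReal (ha₀ _).le]
      | .inr e =>
        have he := e.2.2
        simp only [endVal, he]
        rw [ENNReal.toReal_add (ENNReal.mul_ne_top ENNReal.ofReal_ne_top (hxt _))
          ENNReal.ofReal_ne_top, ENNReal.toReal_mul, ENNReal.toReal_mul,
          ENNReal.toReal_ofReal (hc _), ENNReal.toReal_ofReal (hk₁ _),
          ENNReal.toReal_ofReal (ha₁' _)]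
    · exact fun a _ => Γ.endVal_ne_top
        (fun e => ENNReal.add_ne_top.2
          ⟨ENNReal.mul_ne_top ENNReal.ofReal_ne_top (hxt _), ENNReal.ofReal_ne_top⟩)
        (fun e => ENNReal.add_ne_top.2
          ⟨ENNReal.mul_ne_top ENNReal.ofReal_ne_top (hxt _), ENNReal.ofReal_ne_top⟩) a
    · exact fun a _ => ENNReal.mul_ne_top
        (Γ.endVal_ne_top (fun e => ENNReal.ofReal_ne_top) (fun e => ENNReal.ofReal_ne_top) a) (hxt v)
  · convert hs using 4 with e
    · rw [ENNReal.ofReal_mul ENNReal.toReal_nonneg, ← hxr]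
    · rw [ENNReal.ofReal_mul ENNReal.toReal_nonneg, ← hxr]

end MetricGraph

/-! ### Topology and measure of the metric graph. -/

namespace MetricGraph

variable {Vert Edge : Type*} (Γ : MetricGraph Vert Edge)

theorem pt_of_nonpos (e : Edge) {t : ℝ} (ht : t ≤ 0) : Γ.pt e t = .vertex (Γ.src e) := by
  simp [pt, not_lt.2 ht]

theorem pt_of_mem {e : Edge} {t : ℝ} (ht : t ∈ Γ.interiorParam e) :
    Γ.pt e t = .interior e t ht.1 ht.2 := by
  simp [pt, ht.1, ht.2]

theorem mem_interiorParam_iff {e : Edge} (he : Γ.len e ≠ ∞) {t : ℝ} :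
    t ∈ Γ.interiorParam e ↔ 0 < t ∧ t < (Γ.len e).toReal :=
  and_congr_right fun ht => ofReal_lt_iff_lt_toReal he ht

theorem toReal_len_pos {e : Edge} (he : Γ.len e ≠ ∞) : 0 < (Γ.len e).toReal :=
  ENNReal.toReal_pos (Γ.len_pos e).ne' he

theorem pt_of_ge {e : Edge} (he : Γ.len e ≠ ∞) {t : ℝ} (ht : (Γ.len e).toReal ≤ t) :
    Γ.pt e t = .vertex (Γ.tgt e) := by
  have h0 : 0 < t := (Γ.toReal_len_pos he).trans_le ht
  have h1 : ¬ ENNReal.ofReal t < Γ.len e := fun h =>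
    ht.not_gt ((ofReal_lt_iff_lt_toReal he h0).1 h)
  simp [pt, h0, h1]

theorem interiorParam_cases (e : Edge) (t : ℝ) :
    t ≤ 0 ∨ t ∈ Γ.interiorParam e ∨ (Γ.len e ≠ ∞ ∧ (Γ.len e).toReal ≤ t) := by
  by_cases h0 : t ≤ 0
  · exact .inl h0
  by_cases h1 : ENNReal.ofReal t < Γ.len e
  · exact .inr (.inl ⟨not_le.1 h0, h1⟩)
  · have he : Γ.len e ≠ ∞ := fun he => h1 (by simp [he])
    exact .inr (.inr ⟨he, not_lt.1 fun h => h1 ((ofReal_lt_iff_lt_toReal he (not_le.1 h0)).2 h)⟩)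

theorem isOpen_interiorParam (e : Edge) : IsOpen (Γ.interiorParam e) :=
  (isOpen_lt continuous_const continuous_id).inter
    (isOpen_lt ENNReal.continuous_ofReal continuous_const)

theorem continuous_pt (e : Edge) : Continuous (Γ.pt e) :=
  continuous_iff_coinduced_le.2 (le_iSup (fun e => TopologicalSpace.coinduced (Γ.pt e) _) e)

theorem isOpen_iff {S : Set Γ.Point} : IsOpen S ↔ ∀ e, IsOpen (Γ.pt e ⁻¹' S) := by
  refine isOpen_iSup_iff.trans (forall_congr' fun e => isOpen_coinduced)

theorem continuous_iff {f : Γ.Point → ℝ} : Continuous f ↔ ∀ e, Continuous fun t => f (Γ.pt e t) :=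
  continuous_iSup_dom.trans (forall_congr' fun _ => continuous_coinduced_dom)

theorem lintegral_vol {F : Γ.Point → ℝ≥0∞} (hF : Measurable F) :
    ∫⁻ x, F x ∂Γ.vol = ∑' e, ∫⁻ t in Γ.interiorParam e, F (Γ.pt e t) := by
  rw [vol, lintegral_sum_measure]
  exact tsum_congr fun e => lintegral_map hF (Γ.continuous_pt e).measurable

/-- The vertices form a closed null set. This is what places the pole inside an edge. -/
theorem exists_interior_of_vol_pos {S : Set Γ.Point} (hS : 0 < Γ.vol S) :
    ∃ e, ∃ t ∈ Γ.interiorParam e, Γ.pt e t ∈ S := by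
  by_contra! h
  set I : Set Γ.Point := {x | ∃ e, ∃ t ∈ Γ.interiorParam e, Γ.pt e t = x} with hI
  have hpre : ∀ e, Γ.pt e ⁻¹' I = Γ.interiorParam e := by
    intro e
    ext t
    refine ⟨fun ⟨e', t', ht', h'⟩ => ?_, fun ht => ⟨e, t, ht, rfl⟩⟩
    rw [Γ.pt_of_mem ht'] at h'
    rcases Γ.interiorParam_cases e t with h0 | h1 | ⟨he, h2⟩
    · rw [Γ.pt_of_nonpos e h0] at h'; cases h'
    · exact h1
    · rw [Γ.pt_of_ge he h2] at h'; cases h'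
  have hIo : IsOpen I := Γ.isOpen_iff.2 fun e => by
    rw [hpre]; exact Γ.isOpen_interiorParam e
  have hSI : S ⊆ Iᶜ := fun x hx ⟨e, t, ht, hxe⟩ => h e t ht (hxe ▸ hx)
  refine (hS.trans_le (measure_mono hSI)).ne' ?_
  rw [vol, Measure.sum_apply _ hIo.measurableSet.compl, ENNReal.tsum_eq_zero]
  intro e
  rw [Measure.map_apply (Γ.continuous_pt e).measurable hIo.measurableSet.compl, preimage_compl,
    hpre, Measure.restrict_apply (Γ.isOpen_interiorParam e).measurableSet.compl, compl_inter_self,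
    measure_empty]

/-- In a connected metric graph, a set of vertices that is closed under passing to the other end
of an edge and contains a vertex contains every vertex. -/
theorem vertex_induction [ConnectedSpace Γ.Point] {P : Vert → Prop} {v₀ : Vert} (h₀ : P v₀)
    (h : ∀ e, Γ.len e ≠ ∞ → (P (Γ.src e) ↔ P (Γ.tgt e))) (v : Vert) : P v := by
  -- Interior points inherit `P` from the start of their edge, so each edge parametrization pulls
  -- `S` back to `∅` or to all of `ℝ`, and `S` is clopen.
  let S : Set Γ.Point := {x | match x with
    | .vertex v => P v
    | .interior e _ _ _ => P (Γ.src e)}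
  have hS : ∀ e t, Γ.pt e t ∈ S ↔ P (Γ.src e) := by
    intro e t
    rcases Γ.interiorParam_cases e t with h0 | h1 | ⟨he, h2⟩
    · rw [Γ.pt_of_nonpos e h0]; rfl
    · rw [Γ.pt_of_mem h1]; rfl
    · rw [Γ.pt_of_ge he h2]; exact (h e he).symm
  have hclopen : IsClopen S := by
    refine ⟨⟨Γ.isOpen_iff.2 fun e => ?_⟩, Γ.isOpen_iff.2 fun e => ?_⟩
    · by_cases hP : P (Γ.src e)
      · convert isOpen_empty
        ext t
        simp [hS, hP]
      · convert isOpen_univ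
        ext t
        simp [hS, hP]
    · by_cases hP : P (Γ.src e)
      · convert isOpen_univ
        ext t
        simp [hS, hP]
      · convert isOpen_empty
        ext t
        simp [hS, hP]
  have hu : S = univ := hclopen.eq_univ ⟨.vertex v₀, h₀⟩
  exact (hu ▸ mem_univ (Point.vertex v) : Point.vertex v ∈ S)

/-! ### Gluing edge functions. -/

/-- The function on the metric graph with values `x` at the vertices and `W e` along the edges. -/
def glue (x : Vert → ℝ) (W : Edge → ℝ → ℝ) : Γ.Point → ℝ
  | .vertex v => x v
  | .interior e t _ _ => W e t

section Glue

variable {Γ} {x : Vert → ℝ} {W : Edge → ℝ → ℝ}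

theorem glue_pt_of_mem {e : Edge} {t : ℝ} (ht : t ∈ Γ.interiorParam e) :
    Γ.glue x W (Γ.pt e t) = W e t := by
  rw [Γ.pt_of_mem ht]; rfl

theorem continuous_glue (hW : ∀ e, Continuous (W e)) (h₀ : ∀ e, W e 0 = x (Γ.src e))
    (h₁ : ∀ e, Γ.len e ≠ ∞ → W e (Γ.len e).toReal = x (Γ.tgt e)) : Continuous (Γ.glue x W) := by
  refine Γ.continuous_iff.2 fun e => ?_
  by_cases he : Γ.len e = ∞
  · have : (fun t => Γ.glue x W (Γ.pt e t)) = fun t => W e (max 0 t) := by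
      ext t
      rcases Γ.interiorParam_cases e t with h | h | h
      · rw [Γ.pt_of_nonpos e h, max_eq_left h, h₀]; rfl
      · rw [glue_pt_of_mem h, max_eq_right h.1.le]
      · exact (h.1 he).elim
    rw [this]
    exact (hW e).comp (continuous_const.max continuous_id)
  · have hL := Γ.toReal_len_pos he
    -- `pt` is constant beyond the ends of the edge, which amounts to clamping the parameter.
    have : (fun t => Γ.glue x W (Γ.pt e t)) = fun t => W e (max 0 (min t (Γ.len e).toReal)) := by
      ext t
      rcases Γ.interiorParam_cases e t with h | h | h
      · rw [Γ.pt_of_nonpos e h, min_eq_left (h.trans hL.le), max_eq_left h, h₀]; rfl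
      · have := (Γ.mem_interiorParam_iff he).1 h
        rw [glue_pt_of_mem h, min_eq_left this.2.le, max_eq_right h.1.le]
      · rw [Γ.pt_of_ge h.1 h.2, min_eq_right h.2, max_eq_right hL.le, h₁ e he]; rfl
    rw [this]
    exact (hW e).comp (continuous_const.max (continuous_id.min continuous_const))

theorem glue_eventuallyEq {e : Edge} {t : ℝ} (ht : t ∈ Γ.interiorParam e) :
    (fun r => Γ.glue x W (Γ.pt e r)) =ᶠ[𝓝 t] W e :=
  ((Γ.isOpen_interiorParam e).eventually_mem ht).mono fun _ hr => glue_pt_of_mem hr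

/-- The pole breaks `W` into two pieces, so a globally smooth `Z` is available only for the
one-sided germ at each end. -/
theorem differentiable_and_tendsto_deriv {f Z Z' : ℝ → ℝ} (h : f =ᶠ[𝓝[>] 0] Z)
    (hZ : ∀ t, HasDerivAt Z (Z' t) t) (hZ' : Continuous Z') :
    (∀ᶠ s in 𝓝[>] (0 : ℝ), DifferentiableAt ℝ f s) ∧ Tendsto (deriv f) (𝓝[>] 0) (𝓝 (Z' 0)) := by
  have key : ∀ᶠ s in 𝓝[>] (0 : ℝ), f =ᶠ[𝓝 s] Z := by
    filter_upwards [eventually_eventually_nhdsWithin.2 h, self_mem_nhdsWithin] with s hs hs0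
    rwa [isOpen_Ioi.nhdsWithin_eq hs0] at hs
  refine ⟨key.mono fun s hs => ((hZ s).congr_of_eventuallyEq hs).differentiableAt, ?_⟩
  refine Tendsto.congr' (key.mono fun s hs =>
    (((hZ s).congr_of_eventuallyEq hs).deriv).symm) ?_
  exact (hZ'.tendsto 0).mono_left nhdsWithin_le_nhds

theorem hasOutgoingDeriv_inl {e : Edge} {v : Vert} (hv : Γ.src e = v) {Z Z' : ℝ → ℝ}
    (hZ : ∀ t, HasDerivAt Z (Z' t) t) (hZ' : Continuous Z') (h : W e =ᶠ[𝓝[>] 0] Z) :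
    Γ.HasOutgoingDeriv (Γ.glue x W) (v := v) (.inl ⟨e, hv⟩) (Z' 0) := by
  refine differentiable_and_tendsto_deriv (EventuallyEq.trans ?_ h) hZ hZ'
  have : ∀ᶠ r : ℝ in 𝓝[>] 0, ENNReal.ofReal r < Γ.len e := by
    refine (ENNReal.continuous_ofReal.tendsto 0).mono_left nhdsWithin_le_nhds |>.eventually_lt_const ?_
    simpa using Γ.len_pos e
  filter_upwards [this, self_mem_nhdsWithin] with r hr hr0
  exact glue_pt_of_mem ⟨hr0, hr⟩

theorem hasOutgoingDeriv_inr {e : Edge} {v : Vert} (hv : Γ.len e ≠ ∞ ∧ Γ.tgt e = v)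
    {Z Z' : ℝ → ℝ} (hZ : ∀ t, HasDerivAt Z (Z' t) t) (hZ' : Continuous Z')
    (h : ∀ᶠ r in 𝓝[>] 0, W e ((Γ.len e).toReal - r) = Z ((Γ.len e).toReal - r)) :
    Γ.HasOutgoingDeriv (Γ.glue x W) (v := v) (.inr ⟨e, hv⟩) (-Z' (Γ.len e).toReal) := by
  have key := differentiable_and_tendsto_deriv
    (f := fun r => Γ.glue x W (Γ.pt e ((Γ.len e).toReal - r)))
    (Z := fun r => Z ((Γ.len e).toReal - r)) (Z' := fun r => -Z' ((Γ.len e).toReal - r))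
    ?_ (fun t => (hZ _).comp_const_sub _ _) (by fun_prop)
  · simp only [sub_zero] at key
    exact key
  · filter_upwards [h, self_mem_nhdsWithin,
      nhdsWithin_le_nhds (Iio_mem_nhds (Γ.toReal_len_pos hv.1))] with r hr hr0 hr1
    rw [← hr]
    exact glue_pt_of_mem ((Γ.mem_interiorParam_iff hv.1).2
      ⟨sub_pos.2 hr1, sub_lt_self _ hr0⟩)

end Glue

end MetricGraph

/-- Interpolation between `L¹` and `L∞`: `f² ≤ C f`. -/
theorem memLp_two_of_bdd_of_lintegral_ne_top {α : Type*} [MeasurableSpace α] {μ : Measure α}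
    {f : α → ℝ} (hf : Measurable f) (h0 : ∀ x, 0 ≤ f x) {C : ℝ} (hC : ∀ x, f x ≤ C)
    (hi : ∫⁻ x, ENNReal.ofReal (f x) ∂μ ≠ ∞) : MemLp f 2 μ := by
  refine (memLp_two_iff_integrable_sq hf.aestronglyMeasurable).2
    ⟨(hf.pow_const 2).aestronglyMeasurable, ?_⟩
  have : ∀ x, ‖f x ^ 2‖ₑ ≤ ENNReal.ofReal C * ENNReal.ofReal (f x) := fun x => by
    rw [Real.enorm_of_nonneg (sq_nonneg _), ← ENNReal.ofReal_mul ((h0 x).trans (hC x)), sq]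
    exact ENNReal.ofReal_le_ofReal (mul_le_mul_of_nonneg_right (hC x) (h0 x))
  refine (lintegral_mono this).trans_lt ?_
  rw [lintegral_const_mul _ hf.ennreal_ofReal]
  exact ENNReal.mul_lt_top ENNReal.ofReal_lt_top hi.lt_top

/-! ### Positivity at the vertices and the Green's function. -/

namespace MetricGraph

variable {Vert Edge : Type*} (Γ : MetricGraph Vert Edge)

/-- If the vertex equations have a source along the edge `e₀`, then a nonnegative solution is
positive. -/
theorem vertex_solution_pos [ConnectedSpace Γ.Point] (hfin : Γ.LocallyFinite)
    {a₀ a₁ c k₀ k₁ : Edge → ℝ} {x : Vert → ℝ} (hx0 : ∀ v, 0 ≤ x v)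
    (hc : ∀ e, 0 ≤ c e) (hc' : ∀ e, Γ.len e ≠ ∞ → 0 < c e)
    (hk₀ : ∀ e, 0 ≤ k₀ e) (hk₁ : ∀ e, 0 ≤ k₁ e) {e₀ : Edge} (hk : 0 < k₀ e₀)
    (hx : ∀ v, ∑ᶠ a : Γ.EdgeEnd v,
      Γ.endVal (fun e => c e * x (Γ.tgt e) + k₀ e - a₀ e * x (Γ.src e))
        (fun e => c e * x (Γ.src e) + k₁ e - a₁ e * x (Γ.tgt e)) a = 0) (v : Vert) : 0 < x v := by
  -- Minimum principle: where `x v = 0` the negative terms disappear, so the remaining nonnegative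
  -- terms, neighbours and source, all vanish.
  have hzero : ∀ v, x v = 0 → ∀ a : Γ.EdgeEnd v,
      Γ.endVal (fun e => c e * x (Γ.tgt e) + k₀ e) (fun e => c e * x (Γ.src e) + k₁ e) a = 0 := by
    intro v hv a
    have := hfin v
    have := Fintype.ofFinite (Γ.EdgeEnd v)
    have h := hx v
    rw [finsum_eq_sum_of_fintype] at h
    have heq : ∀ a : Γ.EdgeEnd v,
        Γ.endVal (fun e => c e * x (Γ.tgt e) + k₀ e - a₀ e * x (Γ.src e))
          (fun e => c e * x (Γ.src e) + k₁ e - a₁ e * x (Γ.tgt e)) a =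
        Γ.endVal (fun e => c e * x (Γ.tgt e) + k₀ e) (fun e => c e * x (Γ.src e) + k₁ e) a :=
      fun a => match a with
      | .inl e => by simp [endVal, e.2, hv]
      | .inr e => by simp [endVal, e.2.2, hv]
    simp only [heq] at h
    refine (Finset.sum_eq_zero_iff_of_nonneg fun a _ => ?_).1 h a (Finset.mem_univ a)
    match a with
    | .inl e => exact add_nonneg (mul_nonneg (hc _) (hx0 _)) (hk₀ _)
    | .inr e => exact add_nonneg (mul_nonneg (hc _) (hx0 _)) (hk₁ _)
  refine Γ.vertex_induction (P := fun v => 0 < x v) (v₀ := Γ.src e₀) ?_ (fun e he => ?_) v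
  · refine (hx0 _).lt_of_ne' fun h => ?_
    have : c e₀ * x (Γ.tgt e₀) + k₀ e₀ = 0 := hzero _ h (.inl ⟨e₀, rfl⟩)
    linarith [mul_nonneg (hc e₀) (hx0 (Γ.tgt e₀))]
  · refine ⟨fun hs => (hx0 _).lt_of_ne' fun h => ?_, fun ht => (hx0 _).lt_of_ne' fun h => ?_⟩
    · have : c e * x (Γ.src e) + k₁ e = 0 := hzero _ h (.inr ⟨e, he, rfl⟩)
      linarith [mul_pos (hc' e he) hs, hk₁ e]
    · have : c e * x (Γ.tgt e) + k₀ e = 0 := hzero _ h (.inl ⟨e, rfl⟩)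
      linarith [mul_pos (hc' e he) ht, hk₀ e]

open Classical in
/-- The Green's function of `-d²/dx² + Q` for a potential `Q ≥ δ > 0`, with its pole at a point in
the interior of an edge: it is continuous, positive, square-integrable and satisfies the equation
off the pole and the Kirchhoff conditions at all vertices. -/
theorem exists_green [ConnectedSpace Γ.Point] (hfin : Γ.LocallyFinite) {ℓmin : ℝ}
    (hℓmin : 0 < ℓmin) (hlen : ∀ e, ENNReal.ofReal ℓmin ≤ Γ.len e) {Q : Γ.Point → ℝ}
    (hQ : Continuous Q) {δ : ℝ} (hδ : 0 < δ) (hQδ : ∀ x, δ ≤ Q x) {e₀ : Edge} {t₀ : ℝ}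
    (ht₀ : t₀ ∈ Γ.interiorParam e₀) :
    ∃ ψ : Γ.Point → ℝ, Continuous ψ ∧ (∀ x, 0 < ψ x) ∧ MemLp ψ 2 Γ.vol ∧
      (∀ e a b, Icc a b ⊆ Γ.interiorParam e → (e = e₀ → t₀ ∉ Icc a b) →
        ∃ Z Z', IsSchrodingerSol (fun t => Q (Γ.pt e t)) Z Z' ∧
          ∀ t ∈ Icc a b, (fun r => ψ (Γ.pt e r)) =ᶠ[𝓝 t] Z) ∧
      ∀ v, ∃ d : Γ.EdgeEnd v → ℝ, (∀ a, Γ.HasOutgoingDeriv ψ a (d a)) ∧ ∑ᶠ a, d a = 0 := by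
  have hp : ∀ e, Nonempty (EdgeProfile (fun t => Q (Γ.pt e t)) (Γ.len e) δ
      (1 + δ * ℓmin ^ 2 / 2)⁻¹) := fun e =>
    EdgeProfile.nonempty (hQ.comp (Γ.continuous_pt e)) hδ (fun t => hQδ _) hℓmin (hlen e)
  set θ := (1 + δ * ℓmin ^ 2 / 2)⁻¹ with hθdef
  have hθ0 : 0 < θ := by positivity
  have hθ1 : θ < 1 := inv_lt_one_of_one_lt₀ (lt_add_of_pos_right 1 (by positivity))
  let p := fun e => (hp e).some
  have ha₀ : ∀ e, 0 < (p e).a₀ := fun e =>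
    pos_of_mul_pos_right ((p e).b_pos.trans_le (p e).b_le₀) hθ0.le
  have ha₁ : ∀ e, Γ.len e ≠ ∞ → 0 < (p e).a₁ := fun e he =>
    pos_of_mul_pos_right ((p e).b_pos.trans_le ((p e).b_le₁ he)) hθ0.le
  have hba₀ : ∀ e, (p e).b ≤ (p e).a₀ := fun e =>
    (p e).b_le₀.trans (mul_le_of_le_one_left (ha₀ e).le hθ1.le)
  have hba₁ : ∀ e, Γ.len e ≠ ∞ → (p e).b ≤ (p e).a₁ := fun e he =>
    ((p e).b_le₁ he).trans (mul_le_of_le_one_left (ha₁ e he).le hθ1.le)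
  -- The function `g` below is, up to a factor, the Green's function of the edge `e₀` with Dirichlet
  -- conditions (decay at infinity on a half-line): `u₀ t₀ * u₁ t` before the pole and `u₁ t₀ * u₀
  -- t` after it. The coefficients make it continuous at `t₀`.
  let α : Edge → ℝ := fun e => if e = e₀ then (p e).u₀ t₀ else 0
  let β : Edge → ℝ := fun e => if e = e₀ then (p e).u₁ t₀ else 0
  have hα : 0 < α e₀ ∧ α e₀ ≤ 1 := by
    simp only [α, if_true]
    exact ⟨(p e₀).u₀_pos t₀ ht₀.1 ht₀.2, (p e₀).u₀_le t₀ ht₀.1 ht₀.2⟩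
  have hβ : 0 < β e₀ := by
    simp only [β, if_true]
    exact (p e₀).u₁_pos t₀ ht₀.1 ht₀.2
  have hβ1 : Γ.len e₀ ≠ ∞ → β e₀ ≤ 1 := fun he => by
    simp only [β, if_true]
    exact (p e₀).u₁_le he t₀ ht₀.1 ht₀.2
  have hα0 : ∀ e, e ≠ e₀ → α e = 0 := fun e he => if_neg he
  have hβ0 : ∀ e, e ≠ e₀ → β e = 0 := fun e he => if_neg he
  have hαnn : ∀ e, 0 ≤ α e := fun e => by
    by_cases he : e = e₀
    exacts [he ▸ hα.1.le, (hα0 e he).ge]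
  have hβnn : ∀ e, 0 ≤ β e := fun e => by
    by_cases he : e = e₀
    exacts [he ▸ hβ.le, (hβ0 e he).ge]
  let c : Edge → ℝ := fun e => if Γ.len e = ∞ then 0 else (p e).b
  have hctop : ∀ e, Γ.len e = ∞ → c e = 0 := fun e he => if_pos he
  have hcfin : ∀ e, Γ.len e ≠ ∞ → c e = (p e).b := fun e he => if_neg he
  have hc : ∀ e, 0 ≤ c e := fun e => by
    by_cases he : Γ.len e = ∞
    exacts [(hctop e he).ge, (hcfin e he).symm ▸ (p e).b_pos.le]
  -- The sources are the outgoing derivatives of `g` at the ends of `e₀`. At the start this is `b *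
  -- α` even on a half-line, so `b` stands there and not `c`, which is zero on half-lines.
  obtain ⟨x, M, hx0, hxM, hx, hxs⟩ := Γ.exists_vertex_solution hfin hθ0.le hθ1
    (a₀ := fun e => (p e).a₀) (a₁ := fun e => (p e).a₁) (c := c)
    (k₀ := fun e => (p e).b * α e) (k₁ := fun e => c e * β e) (e₀ := e₀)
    ha₀ ha₁ (fun e => (p e).a₁_top) hc
    (fun e => by
      by_cases he : Γ.len e = ∞
      · rw [hctop e he]; exact mul_nonneg hθ0.le (ha₀ e).le
      · rw [hcfin e he]; exact (p e).b_le₀)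
    (fun e he => by rw [hcfin e he]; exact (p e).b_le₁ he) hctop
    (fun e => mul_nonneg (p e).b_pos.le (hαnn e)) (fun e => mul_nonneg (hc e) (hβnn e))
    (fun e => by
      by_cases he : e = e₀
      · subst he
        exact (mul_le_of_le_one_right (p e).b_pos.le hα.2).trans (hba₀ e)
      · simp [hα0 e he, (ha₀ e).le])
    (fun e he' => by
      by_cases he : e = e₀
      · subst he
        rw [hcfin e he']
        exact (mul_le_of_le_one_right (p e).b_pos.le (hβ1 he')).trans (hba₁ e he')
      · simp [hβ0 e he, (ha₁ e he').le])
    (fun e he => by simp [hctop e he]) (fun e he => by simp [hα0 e he, hβ0 e he])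
  have hxpos : ∀ v, 0 < x v := Γ.vertex_solution_pos hfin hx0 hc
    (fun e he => (hcfin e he).symm ▸ (p e).b_pos)
    (fun e => mul_nonneg (p e).b_pos.le (hαnn e)) (fun e => mul_nonneg (hc e) (hβnn e))
    (mul_pos (p e₀).b_pos hα.1) hx
  have hM : 0 ≤ M := (hx0 (Γ.src e₀)).trans (hxM _)
  -- On a half-line the growing solution `u₁` must be absent beyond the pole.
  let y : Edge → ℝ := fun e => if Γ.len e = ∞ then 0 else x (Γ.tgt e)
  have hytop : ∀ e, Γ.len e = ∞ → y e = 0 := fun e he => if_pos he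
  have hyfin : ∀ e, Γ.len e ≠ ∞ → y e = x (Γ.tgt e) := fun e he => if_neg he
  have hynn : ∀ e, 0 ≤ y e := fun e => by
    by_cases he : Γ.len e = ∞
    exacts [(hytop e he).ge, (hyfin e he).symm ▸ hx0 _]
  let g : Edge → ℝ → ℝ := fun e t => if t ≤ t₀ then α e * (p e).u₁ t else β e * (p e).u₀ t
  let W : Edge → ℝ → ℝ := fun e t => x (Γ.src e) * (p e).u₀ t + y e * (p e).u₁ t + g e t
  have hg0 : ∀ e, e ≠ e₀ → ∀ t, g e t = 0 := fun e he t => by simp [g, hα0 e he, hβ0 e he]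
  have hgc : ∀ e, Continuous (g e) := fun e => by
    refine Continuous.if_le (continuous_const.mul (p e).sol₁.continuous)
      (continuous_const.mul (p e).sol₀.continuous) continuous_id continuous_const ?_
    rintro t rfl
    by_cases he : e = e₀
    · subst he
      simp [α, β, mul_comm]
    · simp [hα0 e he, hβ0 e he]
  have hWc : ∀ e, Continuous (W e) := fun e =>
    ((continuous_const.mul (p e).sol₀.continuous).add
      (continuous_const.mul (p e).sol₁.continuous)).add (hgc e)
  have hgnn : ∀ e, ∀ t ∈ Γ.interiorParam e, 0 ≤ g e t := fun e t ht => by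
    simp only [g]
    split_ifs
    · exact mul_nonneg (hαnn e) ((p e).u₁_pos t ht.1 ht.2).le
    · exact mul_nonneg (hβnn e) ((p e).u₀_pos t ht.1 ht.2).le
  -- the solutions representing `W` on the two sides of the pole
  have hleft : ∀ e t, (e = e₀ → t ≤ t₀) →
      W e t = x (Γ.src e) * (p e).u₀ t + (y e + α e) * (p e).u₁ t := fun e t h => by
    by_cases he : e = e₀
    · simp only [W, g, if_pos (h he)]; ring
    · simp only [W, hg0 e he, hα0 e he]; ring
  have hright : ∀ e t, (e = e₀ → t₀ < t) →
      W e t = (x (Γ.src e) + β e) * (p e).u₀ t + y e * (p e).u₁ t := fun e t h => by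
    by_cases he : e = e₀
    · simp only [W, g, if_neg (not_le.2 (h he))]; ring
    · simp only [W, hg0 e he, hβ0 e he]; ring
  have hcont : Continuous (Γ.glue x W) := by
    refine continuous_glue hWc (fun e => ?_) fun e he => ?_
    · rw [hleft e 0 fun _ => ht₀.1.le, (p e).u₀_zero, (p e).u₁_zero]; ring
    · rw [hright e _ ?_, (p e).u₀_len he, (p e).u₁_len he, hyfin e he]
      · ring
      · rintro rfl
        exact ((Γ.mem_interiorParam_iff he).1 ht₀).2
  have hpos : ∀ z, 0 < Γ.glue x W z := fun z => match z with
    | .vertex v => hxpos v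
    | .interior e t h₀ h₁ => add_pos_of_pos_of_nonneg (add_pos_of_pos_of_nonneg
        (mul_pos (hxpos _) ((p e).u₀_pos t h₀ h₁))
        (mul_nonneg (hynn e) ((p e).u₁_pos t h₀ h₁).le)) (hgnn e t ⟨h₀, h₁⟩)
  refine ⟨Γ.glue x W, hcont, hpos, ?_, ?_, ?_⟩
  · obtain ⟨B, hB⟩ := (isCompact_Icc (a := 0) (b := t₀)).exists_bound_of_continuousOn
      (continuous_const.mul (p e₀).sol₁.continuous :
        Continuous fun t => α e₀ * (p e₀).u₁ t).continuousOn
    have hB0 : 0 ≤ B := (norm_nonneg _).trans (hB 0 ⟨le_rfl, ht₀.1.le⟩)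
    have hgB : ∀ t ∈ Γ.interiorParam e₀, g e₀ t ≤ (Ioc 0 t₀).indicator (fun _ => B) t +
        β e₀ * (p e₀).u₀ t := fun t ht => by
      have hu := (p e₀).u₀_pos t ht.1 ht.2
      by_cases h : t ≤ t₀
      · rw [indicator_of_mem (show t ∈ Ioc 0 t₀ from ⟨ht.1, h⟩)]
        simp only [g, if_pos h]
        exact ((le_abs_self _).trans (hB t ⟨ht.1.le, h⟩)).trans
          (le_add_of_nonneg_right (mul_nonneg hβ.le hu.le))
      · simp only [g, if_neg h]
        exact le_add_of_nonneg_left (indicator_nonneg (fun _ _ => hB0) _)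
    have hgB' : ∀ e, ∀ t ∈ Γ.interiorParam e, g e t ≤ B + β e₀ := fun e t ht => by
      by_cases he : e = e₀
      · subst he
        refine (hgB t ht).trans (add_le_add (indicator_le_self' (fun _ _ => hB0) t) ?_)
        exact mul_le_of_le_one_right hβ.le ((p e).u₀_le t ht.1 ht.2)
      · rw [hg0 e he]; positivity
    have hgi : ∫⁻ t in Γ.interiorParam e₀, ENNReal.ofReal (g e₀ t) ≠ ∞ := by
      refine ne_top_of_le_ne_top ?_ (setLIntegral_mono (g := fun t =>
        (Ioc 0 t₀).indicator (fun _ => ENNReal.ofReal B) t +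
          ENNReal.ofReal (β e₀) * ENNReal.ofReal ((p e₀).u₀ t)) ?_ fun t ht => ?_)
      · rw [lintegral_add_left (measurable_const.indicator measurableSet_Ioc),
          lintegral_const_mul _ (p e₀).sol₀.continuous.measurable.ennreal_ofReal,
          lintegral_indicator_const measurableSet_Ioc]
        refine ENNReal.add_ne_top.2 ⟨ENNReal.mul_ne_top ENNReal.ofReal_ne_top ?_,
          ENNReal.mul_ne_top ENNReal.ofReal_ne_top
            (ne_top_of_le_ne_top ENNReal.ofReal_ne_top (p e₀).lintegral₀)⟩
        refine ne_top_of_le_ne_top ?_ (Measure.restrict_apply_le _ _)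
        simp
      · exact (measurable_const.indicator measurableSet_Ioc).add
          ((p e₀).sol₀.continuous.measurable.ennreal_ofReal.const_mul _)
      · refine (ENNReal.ofReal_le_ofReal (hgB t ht)).trans (ENNReal.ofReal_add_le.trans ?_)
        rw [ENNReal.ofReal_mul hβ.le]
        gcongr
        by_cases h : t ∈ Ioc 0 t₀
        · simp [h]
        · simp [h]
    refine memLp_two_of_bdd_of_lintegral_ne_top hcont.measurable (fun z => (hpos z).le)
      (C := M + M + (B + β e₀)) (fun z => ?_) ?_
    · match z with
      | .vertex v =>
        have : x v ≤ M := hxM v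
        change x v ≤ _
        linarith
      | .interior e t h₀ h₁ =>
        refine add_le_add (add_le_add ?_ ?_) (hgB' e t ⟨h₀, h₁⟩)
        · exact (mul_le_of_le_one_right (hx0 _) ((p e).u₀_le t h₀ h₁)).trans (hxM _)
        · by_cases he : Γ.len e = ∞
          · rw [hytop e he, zero_mul]; exact hM
          · rw [hyfin e he]
            exact (mul_le_of_le_one_right (hx0 _) ((p e).u₁_le he t h₀ h₁)).trans (hxM _)
    · rw [Γ.lintegral_vol hcont.measurable.ennreal_ofReal]
      -- The edge integrals are at most `δ⁻¹` times the terms of the weighted `ℓ¹` sum `hxs`, plus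
      -- the contribution of `g` on `e₀` alone.
      have hedge : ∀ e, ∫⁻ t in Γ.interiorParam e, ENNReal.ofReal (Γ.glue x W (Γ.pt e t)) ≤
          ENNReal.ofReal (1 / δ) * (ENNReal.ofReal (x (Γ.src e) * (p e).a₀) +
            ENNReal.ofReal (x (Γ.tgt e) * (p e).a₁)) +
          ∫⁻ t in Γ.interiorParam e, ENNReal.ofReal (g e t) := fun e => by
        have h1 : ∫⁻ t in Γ.interiorParam e, ENNReal.ofReal (Γ.glue x W (Γ.pt e t)) ≤
            ∫⁻ t in Γ.interiorParam e, (ENNReal.ofReal (x (Γ.src e)) * ENNReal.ofReal ((p e).u₀ t) +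
              ENNReal.ofReal (y e) * ENNReal.ofReal ((p e).u₁ t) + ENNReal.ofReal (g e t)) := by
          refine setLIntegral_mono' (Γ.isOpen_interiorParam e).measurableSet fun t ht => ?_
          rw [glue_pt_of_mem ht, ← ENNReal.ofReal_mul (hx0 _), ← ENNReal.ofReal_mul (hynn e)]
          exact ENNReal.ofReal_add_le.trans (add_le_add_left ENNReal.ofReal_add_le _)
        have m₀ := (p e).sol₀.continuous.measurable.ennreal_ofReal
        have m₁ := (p e).sol₁.continuous.measurable.ennreal_ofReal
        rw [lintegral_add_right _ (hgc e).measurable.ennreal_ofReal,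
          lintegral_add_right _ (m₁.const_mul _), lintegral_const_mul _ m₀,
          lintegral_const_mul _ m₁] at h1
        refine h1.trans (add_le_add_left ?_ _)
        rw [mul_add]
        refine add_le_add ?_ ?_
        · refine (mul_le_mul_right (p e).lintegral₀ _).trans_eq ?_
          rw [← ENNReal.ofReal_mul (hx0 _), ← ENNReal.ofReal_mul (by positivity)]
          congr 1; ring
        · by_cases he : Γ.len e = ∞
          · simp [hytop e he]
          · refine (mul_le_mul_right ((p e).lintegral₁ he) _).trans_eq ?_
            rw [hyfin e he, ← ENNReal.ofReal_mul (hx0 _), ← ENNReal.ofReal_mul (by positivity)]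
            congr 1; ring
      refine ne_top_of_le_ne_top ?_ (ENNReal.tsum_le_tsum hedge)
      rw [ENNReal.tsum_add, ENNReal.tsum_mul_left,
        tsum_eq_single (f := fun e => ∫⁻ t in Γ.interiorParam e, ENNReal.ofReal (g e t)) e₀
          fun e he => by simp [hg0 e he]]
      exact ENNReal.add_ne_top.2 ⟨ENNReal.mul_ne_top ENNReal.ofReal_ne_top hxs, hgi⟩
  · intro e a b hab hpole
    by_cases hside : e = e₀ → b < t₀
    · refine ⟨_, _, (p e).sol₀.lin_comb (p e).sol₁ (x (Γ.src e)) (y e + α e), fun t ht => ?_⟩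
      refine (glue_eventuallyEq (hab ht)).trans ?_
      by_cases he : e = e₀
      · filter_upwards [Iio_mem_nhds (ht.2.trans_lt (hside he))] with r hr
        exact hleft e r fun _ => (mem_Iio.1 hr).le
      · exact Eventually.of_forall fun r => hleft e r fun h => (he h).elim
    · push Not at hside
      obtain ⟨he, hb⟩ := hside
      have ha : t₀ < a := not_le.1 fun h => hpole he ⟨h, hb⟩
      refine ⟨_, _, (p e).sol₀.lin_comb (p e).sol₁ (x (Γ.src e) + β e) (y e), fun t ht => ?_⟩
      refine (glue_eventuallyEq (hab ht)).trans ?_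
      filter_upwards [Ioi_mem_nhds (ha.trans_le ht.1)] with r hr
      exact hright e r fun _ => hr
  · intro v
    refine ⟨_, fun a => ?_, hx v⟩
    match a with
    | .inl ⟨e, he⟩ =>
      have hs := (p e).sol₀.lin_comb (p e).sol₁ (x (Γ.src e)) (y e + α e)
      convert hasOutgoingDeriv_inl (W := W) (x := x) he hs.deriv₁ hs.continuous_deriv ?_ using 1
      · simp only [endVal, (p e).v₀_zero, (p e).v₁_zero]
        by_cases he' : Γ.len e = ∞
        · rw [hctop e he', hytop e he']; ring
        · rw [hcfin e he', hyfin e he']; ring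
      · filter_upwards [nhdsWithin_le_nhds (Iio_mem_nhds ht₀.1)] with r hr
        exact hleft e r fun _ => (mem_Iio.1 hr).le
    | .inr ⟨e, he⟩ =>
      have hs := (p e).sol₀.lin_comb (p e).sol₁ (x (Γ.src e) + β e) (y e)
      convert hasOutgoingDeriv_inr (W := W) (x := x) he hs.deriv₁ hs.continuous_deriv ?_ using 1
      · simp only [endVal, (p e).v₀_len he.1, (p e).v₁_len he.1, hcfin e he.1, hyfin e he.1]
        ring
      · by_cases he' : e = e₀
        · subst he'
          have := ((Γ.mem_interiorParam_iff he.1).1 ht₀).2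
          filter_upwards [nhdsWithin_le_nhds (Iio_mem_nhds (sub_pos.2 this))] with r hr
          exact hright e _ fun _ => by linarith [mem_Iio.1 hr]
        · exact Eventually.of_forall fun r => hright e _ fun h => (he' h).elim

end MetricGraph

/-! ### Regularity and conclusion. -/

theorem IsSchrodingerSol.deriv_eventuallyEq {q Z Z' f : ℝ → ℝ} (h : IsSchrodingerSol q Z Z')
    {t : ℝ} (hf : f =ᶠ[𝓝 t] Z) :
    (∀ᶠ s in 𝓝 t, DifferentiableAt ℝ f s) ∧ deriv f =ᶠ[𝓝 t] Z' :=
  ⟨hf.eventuallyEq_nhds.mono fun s hs =>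
      ((h.deriv₁ s).congr_of_eventuallyEq hs).differentiableAt,
    hf.eventuallyEq_nhds.mono fun s hs => ((h.deriv₁ s).congr_of_eventuallyEq hs).deriv⟩

theorem IsSchrodingerSol.absolutelyContinuousOnInterval {q Z Z' : ℝ → ℝ}
    (h : IsSchrodingerSol q Z Z') (hq : Continuous q) {a b : ℝ} {f : ℝ → ℝ}
    (hf : EqOn f Z' (uIcc a b)) : AbsolutelyContinuousOnInterval f a b := by
  have hZ : ContDiff ℝ 1 Z' := contDiff_one_iff_deriv.2
    ⟨fun t => (h.deriv₂ t).differentiableAt, by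
      rw [show deriv Z' = fun t => q t * Z t from funext fun t => (h.deriv₂ t).deriv]
      exact hq.mul h.continuous⟩
  exact (hZ.contDiffOn.congr hf).absolutelyContinuousOnInterval

theorem proposition2p1 {Vert Edge : Type*} (Γ : MetricGraph Vert Edge)
    (hfin : Γ.LocallyFinite) [ConnectedSpace Γ.Point]
    (ℓmin : ℝ) (hℓmin : 0 < ℓmin) (hlen : ∀ e, ENNReal.ofReal ℓmin ≤ Γ.len e)
    (V : Γ.Point → ℝ) (hV : Continuous V)
    (i₀ : Set Γ.Point) (hi₀ : IsConnected i₀) (hpos : 0 < Γ.vol i₀)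
    (E : ℝ) (hE : (E : EReal) < ⨅ x ∈ i₀ᶜ, (V x : EReal)) :
    ∃ ψ : Γ.Point → ℝ,
      MemLp ψ 2 Γ.vol ∧
      Γ.SolvesOn i₀ᶜ V E ψ ∧
      Γ.KirchhoffOn i₀ᶜ ψ ∧
      (0 < Γ.vol i₀ᶜ → ¬ ∀ᵐ x ∂(Γ.vol.restrict i₀ᶜ), ψ x = 0) := by
  -- A real `r` exists even if the infimum is `+∞`. It is the truncation level that makes the
  -- potential positive on `i₀` as well.
  obtain ⟨r, hEr, hr⟩ := EReal.lt_iff_exists_real_btwn.1 hE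
  have hEr : E < r := EReal.coe_lt_coe_iff.1 hEr
  have hrV : ∀ x ∈ i₀ᶜ, r ≤ V x := fun x hx =>
    (EReal.coe_lt_coe_iff.1 (hr.trans_le (iInf₂_le x hx))).le
  obtain ⟨e₀, t₀, ht₀, hpole⟩ := Γ.exists_interior_of_vol_pos hpos
  have hQ : Continuous fun x => max (V x) r - E := (hV.max continuous_const).sub continuous_const
  obtain ⟨ψ, hψc, hψpos, hψ2, hsol, hK⟩ := Γ.exists_green hfin hℓmin hlen hQ
    (sub_pos.2 hEr) (fun x => sub_le_sub_right (le_max_right _ _) _) ht₀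
  refine ⟨ψ, hψ2, fun e t ht hx => ?_, ⟨fun e a b hab hI hS => ?_, fun v _ => ?_⟩, fun hv h => ?_⟩
  · obtain ⟨Z, Z', hZ, hZψ⟩ := hsol e t t (by simpa using ht) fun he h => by
      rw [Icc_self, mem_singleton_iff] at h
      subst he h
      exact hx hpole
    have hloc := hZψ t (by simp)
    obtain ⟨hd, hd'⟩ := hZ.deriv_eventuallyEq hloc
    refine ⟨hd, _, (hZ.deriv₂ t).congr_of_eventuallyEq hd', ?_⟩
    rw [← hloc.eq_of_nhds, max_eq_left (hrV _ hx)]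
    ring
  · obtain ⟨Z, Z', hZ, hZψ⟩ := hsol e a b hI fun he h => by
      subst he
      exact hS h hpole
    refine ⟨fun t ht => (hZ.deriv_eventuallyEq (hZψ t ht)).1.self_of_nhds, ?_⟩
    refine hZ.absolutelyContinuousOnInterval (hQ.comp (Γ.continuous_pt e)) fun t ht => ?_
    rw [uIcc_of_le hab] at ht
    exact (hZ.deriv_eventuallyEq (hZψ t ht)).2.eq_of_nhds
  · exact ⟨hψc.continuousAt, hK v⟩
  · have hF : ∀ᵐ x ∂(Γ.vol.restrict i₀ᶜ), False := h.mono fun x hx => (hψpos x).ne' hx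
    rw [ae_iff] at hF
    simp only [not_false_eq_true, ofPred_true, Measure.restrict_apply_univ] at hF
    exact hv.ne' hF
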